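/- Let $L(s)$ be a Dirichlet series with the following properties: (I) $L(s)=\sum_{n=1}^\infty \frac{a(n)}{n^s}$, with complex coefficients $a(n)$, is absolutely convergent for $\sigma=\operatorname{Re}(s)>1$; (II) $\log L(s)=\sum_p\sum_{k=1}^\infty \frac{b(p^k)}{p^{ks}}$ is absolutely convergent for $\sigma>1$ (that is, for every $s$ with $\sigma>1$ the double series, over all primes $p$ and all integers $k\ge 1$, converges absolutely and its exponential equals $L(s)$), and there exist $K>0$ and $\theta<1/2$ such that $|b(p^k)|\le K p^{k\theta}$ for every prime $p$ and every integer $k\ge 1$; (III) $\sum_p |a(p)|p^{-\sigma}\to\infty$ as $\sigma\to 1^+$. Then there is $N_0$, depending on $L$, such that $L(s)+L(2s)+\cdots+L(Ns)$ has infinitely many zeros in the half-plane $\sigma>1$ for every $N\ge N_0$, and the same holds for $N=2$. If furthermore $|a(n)|\le n^{1/4}$ for every $n\ge 2$, then $L(s)+L(2s)+\cdots+L(Ns)$ has infinitely many zeros for $\sigma>1$ for every $N\ge 2$. -/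

import Mathlib

open Filter Topology

/-! A vertical shift s ↦ s + it multiplies p^(-s) by p^(-it). The logarithms of the primes are
independent over ℤ, so Kronecker's theorem makes the points (p^(-it))_p with t large dense in the
torus of all twists u (`exists_primeFlow_mem`). By Hurwitz's argument it then suffices that one
twisted sum has a zero with Re s > 1 (`exists_zero_of_twist_eq_zero`).

To find that twist (`exists_twist_eq_zero`), one solves log L = log(-M) at a real σ > 1, where M is
the twisted tail L(2s) + ⋯ + L(Ns). The tail is holomorphic for Re s > 1/2, so fixing finitely many
coordinates of u keeps it near a nonzero value g₀ for σ close to 1. All other primes remain free.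
The sum of |b(p)| p^(-σ) diverges as σ → 1⁺, because a(p) = b(p) (`coeff_prime_eq`), while θ < 1/2
keeps the terms with k ≥ 2 bounded. Free primes split into four classes of nearly equal weight
(`exists_balanced_colouring`), pointed in the directions 1, i, -1, -i, nearly cancel; small
rotations of two classes absorb all bounded errors by a contraction (`exists_angles_eq_zero`). This
works for every N ≥ 2. -/

/-! ### Kronecker's theorem by means of trigonometric polynomials. -/

/-- The long-time mean of a nontrivial character of the real line vanishes. -/
lemma tendsto_mean_exp (l T : ℝ) :
    Tendsto (fun R : ℝ => (∫ t in T..(T + R), Complex.exp (t * l * Complex.I)) / (R : ℂ)) atTop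
      (𝓝 (if l = 0 then 1 else 0)) := by
  split_ifs with h
  · subst h
    refine tendsto_const_nhds.congr' ?_
    filter_upwards [eventually_gt_atTop 0] with R hR
    have : (R : ℂ) ≠ 0 := by exact_mod_cast hR.ne'
    simp [this]
  · have hc : (l * Complex.I : ℂ) ≠ 0 := by simp [h]
    have key : ∀ R : ℝ, ‖∫ t in T..(T + R), Complex.exp (t * l * Complex.I)‖ ≤ 2 / |l| := by
      intro R
      have : ∀ t : ℝ, Complex.exp (t * l * Complex.I) = Complex.exp ((l * Complex.I) * t) := by
        intro t; ring_nf
      simp_rw [this]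
      rw [integral_exp_mul_complex hc, norm_div]
      have h1 : ∀ t : ℝ, ‖Complex.exp (l * Complex.I * t)‖ = 1 := by
        intro t
        rw [show (l * Complex.I * t : ℂ) = ((l * t : ℝ) : ℂ) * Complex.I by push_cast; ring]
        exact Complex.norm_exp_ofReal_mul_I _
      have h2 := norm_sub_le (Complex.exp (l * Complex.I * (T + R : ℝ)))
        (Complex.exp (l * Complex.I * T))
      rw [h1, h1] at h2
      have h3 : ‖(l * Complex.I : ℂ)‖ = |l| := by simp
      rw [h3]
      gcongr
      linarith
    have hz : Tendsto (fun R : ℝ => (2 / |l|) / R) atTop (𝓝 0) :=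
      tendsto_const_nhds.div_atTop tendsto_id
    refine squeeze_zero_norm' ?_ hz
    filter_upwards [eventually_gt_atTop 0] with R hR
    rw [norm_div, Complex.norm_real, Real.norm_of_nonneg hR.le]
    exact div_le_div_of_nonneg_right (key R) hR.le

/-- The long-time mean of a trigonometric polynomial is the sum of its coefficients at
frequency zero. -/
lemma tendsto_mean_trigPoly {κ : Type*} (J : Finset κ) (c : κ → ℂ) (l : κ → ℝ) (T : ℝ) :
    Tendsto (fun R : ℝ =>
      (∫ t in T..(T + R), ∑ j ∈ J, c j * Complex.exp (t * l j * Complex.I)) / (R : ℂ)) atTop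
      (𝓝 (∑ j ∈ J, if l j = 0 then c j else 0)) := by
  have : ∀ R : ℝ, (∫ t in T..(T + R), ∑ j ∈ J, c j * Complex.exp (t * l j * Complex.I)) / (R : ℂ)
      = ∑ j ∈ J, c j * ((∫ t in T..(T + R), Complex.exp (t * l j * Complex.I)) / (R : ℂ)) := by
    intro R
    rw [intervalIntegral.integral_finsetSum, Finset.sum_div]
    · refine Finset.sum_congr rfl fun j _ => ?_
      rw [intervalIntegral.integral_const_mul, mul_div_assoc]
    · intro j _
      apply Continuous.intervalIntegrable
      fun_prop
  simp_rw [this]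
  refine tendsto_finsetSum _ fun j _ => ?_
  simpa using (tendsto_mean_exp (l j) T).const_mul (c j)

/-- The kernel `|(1 + w) / 2| ^ (2 m)` on the unit circle as a Laurent polynomial. -/
lemma norm_one_add_pow_eq_sum (w : ℂ) (hw : ‖w‖ = 1) (m : ℕ) :
    (((‖1 + w‖ / 2) ^ (2 * m) : ℝ) : ℂ) =
      ∑ j ∈ Finset.range (2 * m + 1), ((2 * m).choose j / 4 ^ m : ℂ) * w ^ ((j : ℤ) - m) := by
  have hw0 : w ≠ 0 := by intro h; simp [h] at hw
  have hconj : (starRingEnd ℂ) w = w⁻¹ := by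
    rw [Complex.inv_def, Complex.normSq_eq_norm_sq, hw]; simp
  have h1 : ((‖1 + w‖ ^ 2 : ℝ) : ℂ) = (1 + w) ^ 2 * w⁻¹ := by
    have := Complex.mul_conj (1 + w)
    rw [Complex.normSq_eq_norm_sq] at this
    rw [← this, map_add, map_one, hconj]
    field_simp
    ring
  have h2 : (((‖1 + w‖ / 2) ^ (2 * m) : ℝ) : ℂ) = ((1 + w) ^ (2 * m)) * (w⁻¹) ^ m / 4 ^ m := by
    rw [pow_mul, div_pow]
    push_cast
    push_cast at h1
    rw [h1, div_pow, mul_pow, ← pow_mul]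
    norm_num
  rw [h2, add_comm, add_pow, Finset.sum_mul, Finset.sum_div]
  refine Finset.sum_congr rfl fun j _ => ?_
  rw [zpow_sub₀ hw0, zpow_natCast, zpow_natCast]
  simp
  ring

/-- **Kronecker's theorem** for a linear flow with rationally independent frequencies. -/
theorem exists_forall_norm_exp_sub_lt {ι : Type*} [Fintype ι] (l : ι → ℝ)
    (hl : ∀ n : ι → ℤ, ∑ i, (n i : ℝ) * l i = 0 → n = 0) (u : ι → Circle) {ε : ℝ} (hε : 0 < ε)
    (T : ℝ) : ∃ t ≥ T, ∀ i, ‖Complex.exp (t * l i * Complex.I) - u i‖ < ε := by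
  classical
  -- If the orbit avoids the target, the kernel ∏ |(1 + w_i)/2|^(2m) is at most d^m along it with d
  -- < 1. Its mean, however, is the constant coefficient, which decays only polynomially in m.
  by_contra! hbad
  wlog hε2 : ε < 2 generalizing ε
  · exact this (ε := 1) one_pos (fun t ht => by
      obtain ⟨i, hi⟩ := hbad t ht; exact ⟨i, by linarith⟩) (by norm_num)
  -- From the parallelogram law |1 + w|² = 4 - |1 - w|²; `ε < 2` makes `d` nonnegative.
  set d : ℝ := 1 - ε ^ 2 / 4 with hd
  have hd0 : 0 ≤ d := by rw [hd]; nlinarith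
  have hd1 : d < 1 := by rw [hd]; nlinarith
  set w : ι → ℝ → ℂ := fun i t => Complex.exp (t * l i * Complex.I) * (u i : ℂ)⁻¹ with hw
  have hexp : ∀ i (t : ℝ), ‖Complex.exp (t * l i * Complex.I)‖ = 1 := by
    intro i t
    rw [show (t * l i : ℂ) = ((t * l i : ℝ) : ℂ) by push_cast; ring]
    exact Complex.norm_exp_ofReal_mul_I _
  have hwn : ∀ i t, ‖w i t‖ = 1 := by
    intro i t
    simp [hw, hexp, Circle.norm_coe]
  have hker : ∀ i t, ‖1 + w i t‖ ≤ 2 := by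
    intro i t
    have := norm_add_le 1 (w i t)
    rw [hwn] at this
    norm_num at this
    linarith
  have hker_bad : ∀ i (t : ℝ), ε ≤ ‖Complex.exp (t * l i * Complex.I) - u i‖ →
      (‖1 + w i t‖ / 2) ^ 2 ≤ d := by
    intro i t h
    have h1 : ‖w i t - 1‖ = ‖Complex.exp (t * l i * Complex.I) - u i‖ := by
      have : w i t - 1 = (Complex.exp (t * l i * Complex.I) - u i) * (u i : ℂ)⁻¹ := by
        simp [hw, sub_mul]
      rw [this, norm_mul]; simp [Circle.norm_coe]
    have h2 := parallelogram_law_with_norm ℝ (1 : ℂ) (w i t)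
    rw [hwn, norm_sub_rev, h1] at h2
    norm_num at h2
    rw [hd, div_pow]
    nlinarith
  have hprod : ∀ m : ℕ, ∀ t ≥ T, ∏ i, (‖1 + w i t‖ / 2) ^ (2 * m) ≤ d ^ m := by
    intro m t ht
    obtain ⟨i, hi⟩ := hbad t ht
    rw [← Finset.mul_prod_erase _ _ (Finset.mem_univ i)]
    have h1 : (‖1 + w i t‖ / 2) ^ (2 * m) ≤ d ^ m := by
      rw [pow_mul]
      exact pow_le_pow_left₀ (by positivity) (hker_bad i t hi) m
    have h2 : ∏ k ∈ Finset.univ.erase i, (‖1 + w k t‖ / 2) ^ (2 * m) ≤ 1 := by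
      refine Finset.prod_le_one (fun k _ => by positivity) fun k _ => ?_
      refine pow_le_one₀ (by positivity) ?_
      have := hker k t
      linarith
    calc _ ≤ d ^ m * 1 := mul_le_mul h1 h2 (Finset.prod_nonneg fun k _ => by positivity)
            (by positivity)
      _ = d ^ m := mul_one _
  have hmean : ∀ m : ℕ, ((m.centralBinom : ℝ) / 4 ^ m) ^ (Fintype.card ι) ≤ d ^ m := by
    intro m
    set J := Fintype.piFinset fun _ : ι => Finset.range (2 * m + 1)
    set c : (ι → ℕ) → ℂ := fun x => ∏ i, ((2 * m).choose (x i) / 4 ^ m : ℂ) *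
      ((u i : ℂ)⁻¹) ^ ((x i : ℤ) - m) with hc
    set L : (ι → ℕ) → ℝ := fun x => ∑ i, (((x i : ℤ) - m : ℤ) : ℝ) * l i with hL
    have hexpand : ∀ t : ℝ, ((∏ i, (‖1 + w i t‖ / 2) ^ (2 * m) : ℝ) : ℂ) =
        ∑ x ∈ J, c x * Complex.exp (t * L x * Complex.I) := by
      intro t
      rw [Complex.ofReal_prod]
      simp_rw [norm_one_add_pow_eq_sum _ (hwn _ t) m]
      rw [Finset.prod_univ_sum]
      refine Finset.sum_congr rfl fun x _ => ?_
      have hE : Complex.exp (t * L x * Complex.I) =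
          ∏ i, (Complex.exp (t * l i * Complex.I)) ^ ((x i : ℤ) - m) := by
        simp_rw [← Complex.exp_int_mul]
        rw [← Complex.exp_sum]
        congr 1
        rw [hL]
        push_cast
        rw [Finset.mul_sum, Finset.sum_mul]
        exact Finset.sum_congr rfl fun i _ => by ring
      rw [hE, hc, ← Finset.prod_mul_distrib]
      refine Finset.prod_congr rfl fun i _ => ?_
      rw [hw]
      simp only [mul_zpow]
      ring
    have hlim := tendsto_mean_trigPoly J c L T
    -- Independence leaves a single zero frequency, the one with all exponents x i - m equal to 0.
    have hzero : ∀ x, L x = 0 ↔ x = fun _ => m := by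
      intro x
      constructor
      · intro h
        have := hl _ h
        funext i
        have h3 := congrFun this i
        simp at h3
        omega
      · rintro rfl; simp [hL]
    have hsum : (∑ x ∈ J, if L x = 0 then c x else 0) =
        (((m.centralBinom : ℝ) / 4 ^ m) ^ (Fintype.card ι) : ℝ) := by
      simp_rw [hzero]
      rw [Finset.sum_ite_eq', if_pos (by simp [J]; omega)]
      simp [hc, Nat.centralBinom, div_pow]
    rw [hsum] at hlim
    have hlim' := (Complex.continuous_re.tendsto _).comp hlim
    rw [Complex.ofReal_re] at hlim'
    refine le_of_tendsto hlim' ?_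
    filter_upwards [eventually_gt_atTop 0] with R hR
    simp only [Function.comp]
    simp_rw [← hexpand]
    rw [intervalIntegral.integral_ofReal, ← Complex.ofReal_div, Complex.ofReal_re, div_le_iff₀ hR]
    have hcont : Continuous fun t : ℝ => ∏ i, (‖1 + w i t‖ / 2) ^ (2 * m) := by
      simp only [hw]; fun_prop
    calc _ ≤ ∫ _ in T..(T + R), d ^ m := by
          refine intervalIntegral.integral_mono_on (by linarith) (hcont.intervalIntegrable _ _)
            (by simp) fun t ht => hprod m t ht.1
      _ = d ^ m * R := by simp [mul_comm]
  have hlow : ∀ m : ℕ, 1 ≤ (2 * (m : ℝ) + 1) ^ (Fintype.card ι) * d ^ m := by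
    intro m
    have h1 : (4 : ℝ) ^ m ≤ (2 * m + 1) * m.centralBinom := by
      exact_mod_cast Nat.four_pow_le_two_mul_add_one_mul_central_binom m
    have h2 : 1 ≤ (2 * (m : ℝ) + 1) * (m.centralBinom / 4 ^ m) := by
      rw [← mul_div_assoc, one_le_div (by positivity)]
      exact h1
    calc (1 : ℝ) ≤ ((2 * (m : ℝ) + 1) * (m.centralBinom / 4 ^ m)) ^ (Fintype.card ι) :=
          one_le_pow₀ h2
      _ ≤ _ := by
          rw [mul_pow]
          exact mul_le_mul_of_nonneg_left (hmean m) (by positivity)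
  have hlim : Tendsto (fun m : ℕ => (3 : ℝ) ^ (Fintype.card ι) *
      ((m : ℝ) ^ (Fintype.card ι) * d ^ m)) atTop (𝓝 0) := by
    have := (tendsto_pow_const_mul_const_pow_of_abs_lt_one (Fintype.card ι) (r := d)
      (by rwa [abs_of_nonneg hd0])).const_mul ((3 : ℝ) ^ (Fintype.card ι))
    simpa using this
  obtain ⟨m, hm, hm1⟩ := ((hlim.eventually (gt_mem_nhds one_pos)).and
    (eventually_ge_atTop 1)).exists
  have hm1' : (1 : ℝ) ≤ m := by exact_mod_cast hm1
  have h3 : (2 * (m : ℝ) + 1) ^ (Fintype.card ι) ≤ (3 * m) ^ (Fintype.card ι) :=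
    pow_le_pow_left₀ (by positivity) (by linarith) _
  have h4 := hlow m
  have h5 : (0 : ℝ) ≤ d ^ m := by positivity
  rw [mul_pow] at h3
  nlinarith [mul_le_mul_of_nonneg_right h3 h5]

/-! ### Density of the prime flow in the torus. -/

/-- Logarithms of distinct primes are linearly independent over the integers. -/
lemma eq_zero_of_sum_mul_log_primes (I : Finset Nat.Primes) (n : I → ℤ)
    (h : ∑ i, (n i : ℝ) * Real.log ((i : Nat.Primes) : ℕ) = 0) : n = 0 := by
  have hpos : ∀ i : I, (0 : ℝ) < (((i : Nat.Primes) : ℕ) : ℝ) := fun i => by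
    exact_mod_cast (i : Nat.Primes).2.pos
  -- Exponentiation gives a multiplicative relation between primes; over ℚ, the j-adic valuation
  -- reads off `n j`.
  have h1 : ∏ i : I, (((i : Nat.Primes) : ℕ) : ℝ) ^ n i = 1 := by
    rw [← Real.exp_zero, ← h, Real.exp_sum]
    refine Finset.prod_congr rfl fun i _ => ?_
    rw [← Real.log_zpow, Real.exp_log (zpow_pos (hpos i) _)]
  have h2 : ∏ i : I, (((i : Nat.Primes) : ℕ) : ℚ) ^ n i = 1 := by
    apply Rat.cast_injective (α := ℝ)
    push_cast
    exact h1
  funext j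
  have hj : Fact ((j : Nat.Primes) : ℕ).Prime := ⟨(j : Nat.Primes).2⟩
  have h3 := congrArg (padicValRat ((j : Nat.Primes) : ℕ)) h2
  have hne : ∀ i : I, (((i : Nat.Primes) : ℕ) : ℚ) ≠ 0 := fun i => by
    exact_mod_cast (i : Nat.Primes).2.ne_zero
  have h4 : ∀ s : Finset I, padicValRat ((j : Nat.Primes) : ℕ)
      (∏ i ∈ s, (((i : Nat.Primes) : ℕ) : ℚ) ^ n i) = ∑ i ∈ s, if i = j then n i else 0 := by
    classical
    intro s
    induction s using Finset.induction_on with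
    | empty => simp
    | insert a s ha ih =>
      rw [Finset.prod_insert ha, Finset.sum_insert ha, padicValRat.mul
        (zpow_ne_zero _ (hne a)) (Finset.prod_ne_zero_iff.2 fun i _ => zpow_ne_zero _ (hne i)),
        ih, padicValRat.zpow]
      congr 1
      split_ifs with hij
      · subst hij
        simp [padicValRat.self (a : Nat.Primes).2.one_lt]
      · have : padicValNat ((j : Nat.Primes) : ℕ) ((a : Nat.Primes) : ℕ) = 0 := by
          have hf : Fact ((a : Nat.Primes) : ℕ).Prime := ⟨(a : Nat.Primes).2⟩
          exact padicValNat_primes fun hh => hij (Subtype.ext (Subtype.ext hh.symm))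
        simp [this]
  rw [h4] at h3
  simpa using h3

/-- The one-parameter group `t ↦ (p ^ (-it))_p` in the product of circles over the primes. -/
noncomputable def primeFlow (t : ℝ) : Nat.Primes → Circle :=
  fun p => Circle.exp (-(t * Real.log (p : ℕ)))

/-- The forward orbit of the prime flow is dense in the infinite-dimensional torus. -/
theorem exists_primeFlow_mem {U : Set (Nat.Primes → Circle)} {u : Nat.Primes → Circle}
    (hU : U ∈ 𝓝 u) (T : ℝ) : ∃ t ≥ T, primeFlow t ∈ U := by
  -- A neighbourhood in the product topology constrains only finitely many primes, so the finite
  -- form of Kronecker's theorem suffices.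
  rw [nhds_pi, Filter.mem_pi] at hU
  obtain ⟨I, hI, V, hV, hVU⟩ := hU
  have hb : ∀ p : Nat.Primes, ∃ ε > 0, Metric.ball (u p) ε ⊆ V p := fun p =>
    Metric.mem_nhds_iff.1 (hV p)
  choose ε hε hεV using hb
  obtain ⟨δ, hδ, hδε⟩ : ∃ δ > 0, ∀ p ∈ hI.toFinset, δ ≤ ε p := by
    rcases hI.toFinset.eq_empty_or_nonempty with h | h
    · exact ⟨1, one_pos, by simp [h]⟩
    · obtain ⟨p, _, hp⟩ := Finset.exists_min_image _ ε h
      exact ⟨ε p, hε p, hp⟩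
  have hl : ∀ n : hI.toFinset → ℤ,
      ∑ i, (n i : ℝ) * (-Real.log ((i : Nat.Primes) : ℕ)) = 0 → n = 0 := by
    intro n hn
    refine eq_zero_of_sum_mul_log_primes hI.toFinset n ?_
    simpa [Finset.sum_neg_distrib] using hn
  obtain ⟨t, ht, h⟩ := exists_forall_norm_exp_sub_lt _ hl (fun i => u i) hδ T
  refine ⟨t, ht, hVU fun p hp => hεV p ?_⟩
  have hp' : p ∈ hI.toFinset := hI.mem_toFinset.2 hp
  have h1 := (h ⟨p, hp'⟩).trans_le (hδε p hp')
  rw [Metric.mem_ball]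
  change dist (primeFlow t p : ℂ) (u p : ℂ) < ε p
  rw [dist_eq_norm]
  rwa [show (primeFlow t p : ℂ) =
    Complex.exp (t * ((-Real.log (p : ℕ) : ℝ) : ℂ) * Complex.I) by
      simp [primeFlow, Circle.coe_exp, -Complex.natCast_log, Complex.exp_neg]]

/-! ### Twisted logarithms of the Dirichlet series. -/

/-- The term `b(p^k) (u_p p^{-s})^k`, indexed by `q = (p, k - 1)`. -/
noncomputable def logTerm (b : ℕ → ℂ) (u : Nat.Primes → Circle) (s : ℂ) (q : Nat.Primes × ℕ) : ℂ :=
  b ((q.1 : ℕ) ^ (q.2 + 1)) * ((u q.1 : ℂ) * ((q.1 : ℕ) : ℂ) ^ (-s)) ^ (q.2 + 1)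

/-- The logarithm of the Dirichlet series twisted by the completely multiplicative unimodular
function determined by `u`. -/
noncomputable def logSeries (b : ℕ → ℂ) (u : Nat.Primes → Circle) (s : ℂ) : ℂ :=
  ∑' q, logTerm b u s q

/-- The norm of `logTerm` at real part `σ`. -/
noncomputable def logMajorant (b : ℕ → ℂ) (σ : ℝ) (q : Nat.Primes × ℕ) : ℝ :=
  ‖b ((q.1 : ℕ) ^ (q.2 + 1))‖ * (((q.1 : ℕ) : ℝ) ^ (-σ)) ^ (q.2 + 1)

lemma logMajorant_nonneg (b : ℕ → ℂ) (σ : ℝ) (q : Nat.Primes × ℕ) : 0 ≤ logMajorant b σ q := by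
  unfold logMajorant; positivity

lemma norm_logTerm (b : ℕ → ℂ) (u : Nat.Primes → Circle) (s : ℂ) (q : Nat.Primes × ℕ) :
    ‖logTerm b u s q‖ = logMajorant b s.re q := by
  simp [logTerm, logMajorant, Circle.norm_coe, Complex.norm_natCast_cpow_of_pos q.1.2.pos]

lemma logMajorant_anti (b : ℕ → ℂ) {σ τ : ℝ} (h : σ ≤ τ) (q : Nat.Primes × ℕ) :
    logMajorant b τ q ≤ logMajorant b σ q := by
  unfold logMajorant
  have : (1 : ℝ) ≤ ((q.1 : ℕ) : ℝ) := by exact_mod_cast q.1.2.one_le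
  gcongr

lemma continuous_logTerm (b : ℕ → ℂ) (q : Nat.Primes × ℕ) :
    Continuous fun x : (Nat.Primes → Circle) × ℂ => logTerm b x.1 x.2 q := by
  unfold logTerm
  have h : Continuous fun x : (Nat.Primes → Circle) × ℂ => ((q.1 : ℕ) : ℂ) ^ (-x.2) :=
    continuous_const.cpow continuous_snd.neg fun _ => Or.inl (by exact_mod_cast q.1.2.pos)
  have h2 : Continuous fun x : (Nat.Primes → Circle) × ℂ => ((x.1 q.1 : Circle) : ℂ) :=
    continuous_induced_dom.comp ((continuous_apply q.1).comp continuous_fst)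
  fun_prop

lemma differentiable_logTerm (b : ℕ → ℂ) (u : Nat.Primes → Circle) (q : Nat.Primes × ℕ) :
    Differentiable ℂ fun s => logTerm b u s q := by
  unfold logTerm
  have : ((q.1 : ℕ) : ℂ) ≠ 0 := by exact_mod_cast q.1.2.ne_zero
  have h : Differentiable ℂ fun s : ℂ => ((q.1 : ℕ) : ℂ) ^ (-s) := fun s =>
    (differentiableAt_id.neg).const_cpow (Or.inl this)
  fun_prop

section
variable {b : ℕ → ℂ} (hb : ∀ σ : ℝ, 1 < σ → Summable (logMajorant b σ))
include hb

lemma summable_logTerm (u : Nat.Primes → Circle) {s : ℂ} (hs : 1 < s.re) :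
    Summable (logTerm b u s) := by
  refine Summable.of_norm ?_
  simpa only [norm_logTerm] using hb _ hs

/-- The Weierstrass M-test applies jointly in twist and s, because the majorant does not depend on
the twist. -/
lemma continuousAt_logSeries {x : (Nat.Primes → Circle) × ℂ} (hx : 1 < x.2.re) :
    ContinuousAt (fun x : (Nat.Primes → Circle) × ℂ => logSeries b x.1 x.2) x := by
  obtain ⟨σ, h1, h2⟩ := exists_between hx
  have hc : ContinuousOn (fun x : (Nat.Primes → Circle) × ℂ => logSeries b x.1 x.2)
      {x | σ < x.2.re} := by
    refine continuousOn_tsum (fun q => (continuous_logTerm b q).continuousOn) (hb σ h1) ?_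
    intro q y hy
    rw [norm_logTerm]
    exact logMajorant_anti b (le_of_lt hy) q
  refine hc.continuousAt (IsOpen.mem_nhds ?_ h2)
  exact isOpen_lt continuous_const (Complex.continuous_re.comp continuous_snd)

lemma differentiableAt_logSeries (u : Nat.Primes → Circle) {s : ℂ} (hs : 1 < s.re) :
    DifferentiableAt ℂ (logSeries b u) s := by
  obtain ⟨σ, h1, h2⟩ := exists_between hs
  have ho : IsOpen {z : ℂ | σ < z.re} := isOpen_lt continuous_const Complex.continuous_re
  have hd : DifferentiableOn ℂ (logSeries b u) {z | σ < z.re} := by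
    refine Complex.differentiableOn_tsum_of_summable_norm (hb σ h1)
      (fun q => (differentiable_logTerm b u q).differentiableOn) ho ?_
    intro q y hy
    rw [norm_logTerm]
    exact logMajorant_anti b (le_of_lt hy) q
  exact hd.differentiableAt (ho.mem_nhds h2)

/-- Every twisted L tends to 1 at +∞; this later rules out sums that vanish identically. -/
lemma tendsto_logSeries (u : Nat.Primes → Circle) :
    Tendsto (fun σ : ℝ => logSeries b u σ) atTop (𝓝 0) := by
  have h0 : (0 : ℂ) = ∑' _ : Nat.Primes × ℕ, (0 : ℂ) := by simp
  rw [h0]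
  refine tendsto_tsum_of_dominated_convergence (hb 2 (by norm_num)) ?_ ?_
  · intro q
    rw [tendsto_zero_iff_norm_tendsto_zero]
    simp only [norm_logTerm, Complex.ofReal_re, logMajorant]
    have hp : (1 : ℝ) < ((q.1 : ℕ) : ℝ) := by exact_mod_cast q.1.2.one_lt
    have h1 : Tendsto (fun σ : ℝ => ((q.1 : ℕ) : ℝ) ^ (-σ)) atTop (𝓝 0) :=
      (tendsto_rpow_atBot_of_base_gt_one _ hp).comp tendsto_neg_atTop_atBot
    simpa using (h1.pow (q.2 + 1)).const_mul ‖b ((q.1 : ℕ) ^ (q.2 + 1))‖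
  · filter_upwards [eventually_ge_atTop 2] with σ hσ q
    rw [norm_logTerm]
    exact logMajorant_anti b (by simpa using hσ) q

end

/-- At ms a shift of s by it contributes p^(-imt), the m-th power of the flow. One point of the
torus thus governs all L(ms) at once. -/
lemma logTerm_primeFlow_pow (b : ℕ → ℂ) (t : ℝ) (m : ℕ) (s : ℂ) (q : Nat.Primes × ℕ) :
    logTerm b (primeFlow t ^ m) (m * s) q = logTerm b 1 (m * (s + t * Complex.I)) q := by
  have hp : ((q.1 : ℕ) : ℂ) ≠ 0 := by exact_mod_cast q.1.2.ne_zero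
  unfold logTerm
  congr 2
  simp only [Pi.pow_apply, Circle.coe_pow, primeFlow, Circle.coe_exp, Pi.one_apply, Circle.coe_one,
    one_mul]
  rw [Complex.cpow_def_of_ne_zero hp, Complex.cpow_def_of_ne_zero hp, ← Complex.exp_nat_mul,
    ← Complex.exp_add, Complex.ofReal_neg, Complex.ofReal_mul, Complex.ofReal_log (by positivity)]
  congr 1
  push_cast
  ring

lemma logSeries_primeFlow_pow (b : ℕ → ℂ) (t : ℝ) (m : ℕ) (s : ℂ) :
    logSeries b (primeFlow t ^ m) (m * s) = logSeries b 1 (m * (s + t * Complex.I)) :=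
  tsum_congr fun q => logTerm_primeFlow_pow b t m s q

lemma norm_circle_pow_sub_le (z w : Circle) (n : ℕ) :
    ‖((z ^ n : Circle) : ℂ) - ((w ^ n : Circle) : ℂ)‖ ≤ n * ‖(z : ℂ) - w‖ := by
  induction n with
  | zero => simp
  | succ n ih =>
    have h : ((z ^ (n + 1) : Circle) : ℂ) - ((w ^ (n + 1) : Circle) : ℂ) =
        (((z ^ n : Circle) : ℂ) - ((w ^ n : Circle) : ℂ)) * z +
          ((w ^ n : Circle) : ℂ) * ((z : ℂ) - w) := by
      simp only [pow_succ, Circle.coe_mul]; ring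
    rw [h]
    refine (norm_add_le _ _).trans ?_
    rw [norm_mul, norm_mul, Circle.norm_coe, Circle.norm_coe]
    rw [Nat.cast_succ]
    linarith

/-- The factor k = `q.2 + 1`, coming from z^k - w^k, is the reason for the weighted majorants below.
-/
lemma norm_logTerm_sub_le (b : ℕ → ℂ) (u v : Nat.Primes → Circle) (s : ℂ) (q : Nat.Primes × ℕ) :
    ‖logTerm b u s q - logTerm b v s q‖ ≤
      (q.2 + 1) * logMajorant b s.re q * ‖(u q.1 : ℂ) - v q.1‖ := by
  have h : logTerm b u s q - logTerm b v s q =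
      b ((q.1 : ℕ) ^ (q.2 + 1)) * (((q.1 : ℕ) : ℂ) ^ (-s)) ^ (q.2 + 1) *
        (((u q.1 ^ (q.2 + 1) : Circle) : ℂ) - ((v q.1 ^ (q.2 + 1) : Circle) : ℂ)) := by
    simp only [logTerm, Circle.coe_pow]; ring
  rw [h, norm_mul]
  have h1 : ‖b ((q.1 : ℕ) ^ (q.2 + 1)) * (((q.1 : ℕ) : ℂ) ^ (-s)) ^ (q.2 + 1)‖ =
      logMajorant b s.re q := by
    simp [logMajorant, Complex.norm_natCast_cpow_of_pos q.1.2.pos]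
  rw [h1]
  have h2 := norm_circle_pow_sub_le (u q.1) (v q.1) (q.2 + 1)
  push_cast at h2
  calc _ ≤ logMajorant b s.re q * ((q.2 + 1) * ‖(u q.1 : ℂ) - v q.1‖) :=
        mul_le_mul_of_nonneg_left h2 (logMajorant_nonneg _ _ _)
    _ = _ := by ring

section
variable {b : ℕ → ℂ} {K θ : ℝ} (hK : 0 < K) (hθ : θ < 1 / 2)
  (hbound : ∀ p : ℕ, p.Prime → ∀ k : ℕ, 1 ≤ k → ‖b (p ^ k)‖ ≤ K * (p : ℝ) ^ ((k : ℝ) * θ))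
include hbound

lemma logMajorant_le (σ : ℝ) (q : Nat.Primes × ℕ) :
    logMajorant b σ q ≤ K * (((q.1 : ℕ) : ℝ) ^ (θ - σ)) ^ (q.2 + 1) := by
  have hp : (0 : ℝ) < ((q.1 : ℕ) : ℝ) := by exact_mod_cast q.1.2.pos
  have h := hbound q.1 q.1.2 (q.2 + 1) (by omega)
  unfold logMajorant
  calc _ ≤ K * ((q.1 : ℕ) : ℝ) ^ (((q.2 + 1 : ℕ) : ℝ) * θ) *
        (((q.1 : ℕ) : ℝ) ^ (-σ)) ^ (q.2 + 1) := by gcongr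
    _ = _ := by
      rw [mul_comm ((q.2 + 1 : ℕ) : ℝ) θ, Real.rpow_mul_natCast hp.le, mul_assoc, ← mul_pow,
        ← Real.rpow_add hp, sub_eq_add_neg]

include hK hθ

/-- Summability of the weighted majorant, over a range of exponents `k ≥ n`, when the
exponents make the series over the primes converge. -/
lemma summable_weighted_logMajorant {σ : ℝ} (hσ : 1 ≤ σ) (n : ℕ) (hn : (n + 1) * (θ - σ) < -1) :
    Summable fun q : Nat.Primes × ℕ =>
      if q.2 < n then 0 else ((q.2 : ℝ) + 1) * logMajorant b σ q := by
  -- The first n + 1 factors p^(θ-σ) make the sum over primes converge; each remaining factor is at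
  -- most `r`, giving a geometric series in k. For σ = 1 and n = 1 the condition is exactly θ < 1/2.
  set r : ℝ := 2 ^ (θ - σ) with hr
  have hr0 : 0 < r := by positivity
  have hr1 : r < 1 := Real.rpow_lt_one_of_one_lt_of_neg (by norm_num) (by linarith)
  have h1 : Summable fun p : Nat.Primes => ((p : ℕ) : ℝ) ^ ((n + 1) * (θ - σ)) :=
    Nat.Primes.summable_rpow.2 hn
  have h2 : Summable fun k : ℕ => ((k : ℝ) + 1) * (K * r ^ k * (r ^ n)⁻¹) := by
    have ha := summable_pow_mul_geometric_of_norm_lt_one 1 (r := r)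
      (by rwa [Real.norm_of_nonneg hr0.le])
    have hb := summable_geometric_of_lt_one hr0.le hr1
    refine ((ha.add hb).mul_left (K * (r ^ n)⁻¹)).congr fun k => ?_
    ring
  have h3 := h1.mul_of_nonneg h2 (fun p => by positivity) (fun k => by positivity)
  refine Summable.of_nonneg_of_le (fun q => ?_) (fun q => ?_) h3
  · split_ifs
    · exact le_rfl
    · exact mul_nonneg (by positivity) (logMajorant_nonneg _ _ _)
  · split_ifs with hq
    · positivity
    · push Not at hq
      obtain ⟨j, hj⟩ := Nat.exists_eq_add_of_le hq
      have hp : (0 : ℝ) < ((q.1 : ℕ) : ℝ) := by exact_mod_cast q.1.2.pos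
      have hp2 : (2 : ℝ) ≤ ((q.1 : ℕ) : ℝ) := by exact_mod_cast q.1.2.two_le
      have h4 := logMajorant_le hbound σ q
      have h5 : (((q.1 : ℕ) : ℝ) ^ (θ - σ)) ^ (q.2 + 1) ≤
          ((q.1 : ℕ) : ℝ) ^ ((n + 1) * (θ - σ)) * r ^ j := by
        rw [hj, show n + j + 1 = (n + 1) + j by ring, pow_add]
        have h6 : (((q.1 : ℕ) : ℝ) ^ (θ - σ)) ^ (n + 1) =
            ((q.1 : ℕ) : ℝ) ^ ((n + 1) * (θ - σ)) := by
          rw [mul_comm, ← Real.rpow_mul_natCast hp.le]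
          push_cast; rfl
        rw [h6]
        gcongr
        exact Real.rpow_le_rpow_of_nonpos (by norm_num) hp2 (by linarith)
      have h7 : r ^ q.2 * (r ^ n)⁻¹ = r ^ j := by
        rw [hj, pow_add]; field_simp
      calc ((q.2 : ℝ) + 1) * logMajorant b σ q
          ≤ ((q.2 : ℝ) + 1) * (K * (((q.1 : ℕ) : ℝ) ^ ((n + 1) * (θ - σ)) * r ^ j)) := by
            gcongr
            exact h4.trans (mul_le_mul_of_nonneg_left h5 hK.le)
        _ = _ := by rw [← h7]; ring

end

/-! ### Closing a perturbed sum of four vectors. -/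

lemma norm_exp_mul_I_sub_le (x y : ℝ) :
    ‖Complex.exp (x * Complex.I) - Complex.exp (y * Complex.I)‖ ≤ |x - y| := by
  have h : Complex.exp (x * Complex.I) - Complex.exp (y * Complex.I) =
      Complex.exp (y * Complex.I) * (Complex.exp (Complex.I * ((x - y : ℝ) : ℂ)) - 1) := by
    rw [mul_sub, ← Complex.exp_add]
    push_cast
    ring_nf
  rw [h, norm_mul, Complex.norm_exp_ofReal_mul_I, one_mul]
  exact Real.norm_exp_I_mul_ofReal_sub_one_le

/-- Mean value inequality: the derivative i(e^(it) - 1) has norm at most |t| ≤ r. -/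
lemma norm_exp_sub_linear_sub_le {r x y : ℝ} (hx : |x| ≤ r) (hy : |y| ≤ r) :
    ‖(Complex.exp (x * Complex.I) - 1 - x * Complex.I) -
      (Complex.exp (y * Complex.I) - 1 - y * Complex.I)‖ ≤ r * |x - y| := by
  have hd : ∀ t ∈ Set.Icc (-r) r, HasDerivWithinAt
      (fun t : ℝ => Complex.exp (t * Complex.I) - 1 - t * Complex.I)
      (Complex.exp (t * Complex.I) * (1 * Complex.I) - 1 * Complex.I) (Set.Icc (-r) r) t := by
    intro t _
    have h1 : HasDerivAt (fun t : ℝ => (t : ℂ) * Complex.I) (1 * Complex.I) t :=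
      (Complex.ofRealCLM.hasDerivAt (x := t)).mul_const Complex.I
    exact ((h1.cexp.sub_const 1).sub h1).hasDerivWithinAt
  have hb : ∀ t ∈ Set.Icc (-r) r,
      ‖Complex.exp (t * Complex.I) * (1 * Complex.I) - 1 * Complex.I‖ ≤ r := by
    intro t ht
    rw [← sub_one_mul, norm_mul]
    have h2 := norm_exp_mul_I_sub_le t 0
    simp only [Complex.ofReal_zero, zero_mul, Complex.exp_zero, sub_zero] at h2
    simpa using h2.trans (abs_le.2 ht)
  exact (convex_Icc (-r) r).norm_image_sub_le_of_norm_hasDerivWithin_le hd hb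
    (abs_le.1 hy) (abs_le.1 hx)

/-- Four nearly equal vectors in the directions `1, I, -1, -I`: rotating the first two by small
angles solves the perturbed closing equation, provided the perturbation is small relative to the
vectors, in size and in Lipschitz constant. -/
lemma exists_angles_eq_zero (S : Fin 4 → ℝ) (E : ℂ → ℂ) {C : ℝ} (hC : 0 < C)
    (hS : ∀ j, |S j - S 0| ≤ C) (hbig : 100 * C ≤ S 0)
    (hE : ∀ z ∈ Metric.closedBall (0 : ℂ) (1 / 8), ‖E z‖ ≤ C)
    (hL : ∀ z ∈ Metric.closedBall (0 : ℂ) (1 / 8), ∀ w ∈ Metric.closedBall (0 : ℂ) (1 / 8),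
      ‖E z - E w‖ ≤ C * ‖z - w‖) :
    ∃ z : ℂ, S 0 * Complex.exp (z.re * Complex.I) +
      S 1 * (Complex.I * Complex.exp (z.im * Complex.I)) - S 2 - S 3 * Complex.I + E z = 0 := by
  set B := Metric.closedBall (0 : ℂ) (1 / 8) with hB
  have hS0 : 0 < S 0 := by linarith
  set g : ℝ → ℂ := fun x => Complex.exp (x * Complex.I) - 1 - x * Complex.I with hg
  set N : ℂ → ℂ := fun z => S 0 * (g z.re + Complex.I * g z.im) +
    Complex.I * ((S 1 - S 0 : ℝ) : ℂ) * Complex.exp (z.im * Complex.I) - ((S 2 - S 0 : ℝ) : ℂ) -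
      Complex.I * ((S 3 - S 0 : ℝ) : ℂ) + E z with hN
  -- To first order e^(ix) + i e^(iy) - 1 - i = ix - y = iz with z = x + iy, so the linear part is
  -- multiplication by i S₀. The equation becomes a fixed point problem for -N/(i S₀) on the disc of
  -- radius 1/8.
  have hfN : ∀ z : ℂ, S 0 * Complex.exp (z.re * Complex.I) +
      S 1 * (Complex.I * Complex.exp (z.im * Complex.I)) - S 2 - S 3 * Complex.I + E z =
      Complex.I * S 0 * z + N z := by
    intro z
    simp only [hN, hg]
    push_cast
    linear_combination (Complex.I * S 0) * Complex.re_add_im z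
  have hmem : ∀ z ∈ B, |z.re| ≤ 1 / 8 ∧ |z.im| ≤ 1 / 8 := by
    intro z hz
    have : ‖z‖ ≤ 1 / 8 := by simpa [hB] using hz
    exact ⟨(Complex.abs_re_le_norm z).trans this, (Complex.abs_im_le_norm z).trans this⟩
  have hg_lip : ∀ x y : ℝ, |x| ≤ 1 / 8 → |y| ≤ 1 / 8 → ‖g x - g y‖ ≤ 1 / 8 * |x - y| :=
    fun x y hx hy => norm_exp_sub_linear_sub_le hx hy
  have hg0 : g 0 = 0 := by simp [hg]
  have hN_bound : ∀ z ∈ B, ‖N z‖ ≤ S 0 / 8 := by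
    intro z hz
    obtain ⟨h1, h2⟩ := hmem z hz
    have h3 := hg_lip z.re 0 h1 (by norm_num)
    have h4 := hg_lip z.im 0 h2 (by norm_num)
    rw [hg0, sub_zero, sub_zero] at h3 h4
    have h5 : ‖S 0 * (g z.re + Complex.I * g z.im)‖ ≤ S 0 * (1 / 32) := by
      rw [norm_mul, Complex.norm_real, Real.norm_of_nonneg hS0.le]
      refine mul_le_mul_of_nonneg_left ?_ hS0.le
      refine (norm_add_le _ _).trans ?_
      rw [norm_mul, Complex.norm_I]
      linarith
    have h6 : ‖Complex.I * ((S 1 - S 0 : ℝ) : ℂ) * Complex.exp (z.im * Complex.I)‖ ≤ C := by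
      rw [norm_mul, norm_mul, Complex.norm_I, Complex.norm_exp_ofReal_mul_I, Complex.norm_real]
      simpa using hS 1
    have h7 : ‖((S 2 - S 0 : ℝ) : ℂ)‖ ≤ C := by rw [Complex.norm_real]; exact hS 2
    have h8 : ‖Complex.I * ((S 3 - S 0 : ℝ) : ℂ)‖ ≤ C := by
      rw [norm_mul, Complex.norm_I, Complex.norm_real, one_mul]; exact hS 3
    have h9 := hE z hz
    simp only [hN]
    refine (norm_add_le _ _).trans ?_
    refine (add_le_add_left ((norm_sub_le _ _).trans (add_le_add_left ((norm_sub_le _ _).trans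
      (add_le_add_left (norm_add_le _ _) _)) _)) _).trans ?_
    linarith
  have hN_lip : ∀ z ∈ B, ∀ w ∈ B, ‖N z - N w‖ ≤ S 0 / 2 * ‖z - w‖ := by
    intro z hz w hw
    obtain ⟨h1, h2⟩ := hmem z hz
    obtain ⟨h1', h2'⟩ := hmem w hw
    have hre : |z.re - w.re| ≤ ‖z - w‖ := by simpa using Complex.abs_re_le_norm (z - w)
    have him : |z.im - w.im| ≤ ‖z - w‖ := by simpa using Complex.abs_im_le_norm (z - w)
    have h3 := hg_lip z.re w.re h1 h1'
    have h4 := hg_lip z.im w.im h2 h2'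
    have h5 : ‖S 0 * ((g z.re - g w.re) + Complex.I * (g z.im - g w.im))‖ ≤
        S 0 * (1 / 4 * ‖z - w‖) := by
      rw [norm_mul, Complex.norm_real, Real.norm_of_nonneg hS0.le]
      refine mul_le_mul_of_nonneg_left ?_ hS0.le
      refine (norm_add_le _ _).trans ?_
      rw [norm_mul, Complex.norm_I]
      linarith
    have h6 : ‖Complex.I * ((S 1 - S 0 : ℝ) : ℂ) *
        (Complex.exp (z.im * Complex.I) - Complex.exp (w.im * Complex.I))‖ ≤ C * ‖z - w‖ := by
      rw [norm_mul, norm_mul, Complex.norm_I, Complex.norm_real, one_mul]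
      exact mul_le_mul (hS 1) ((norm_exp_mul_I_sub_le _ _).trans him) (norm_nonneg _) hC.le
    have h7 := hL z hz w hw
    have h8 : N z - N w = S 0 * ((g z.re - g w.re) + Complex.I * (g z.im - g w.im)) +
        Complex.I * ((S 1 - S 0 : ℝ) : ℂ) *
        (Complex.exp (z.im * Complex.I) - Complex.exp (w.im * Complex.I)) + (E z - E w) := by
      simp only [hN]; ring
    rw [h8]
    refine (norm_add₃_le).trans ?_
    nlinarith [norm_nonneg (z - w), mul_le_mul_of_nonneg_right hbig (norm_nonneg (z - w))]
  have hI : ‖(Complex.I * S 0 : ℂ)‖ = S 0 := by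
    rw [norm_mul, Complex.norm_I, Complex.norm_real, Real.norm_of_nonneg hS0.le, one_mul]
  have hI0 : (Complex.I * S 0 : ℂ) ≠ 0 := by
    rw [← norm_pos_iff, hI]; exact hS0
  set T : ℂ → ℂ := fun z => -N z / (Complex.I * S 0) with hT
  have hmaps : Set.MapsTo T B B := by
    intro z hz
    rw [hB, mem_closedBall_zero_iff, hT, norm_div, hI, norm_neg, div_le_iff₀ hS0]
    linarith [hN_bound z hz]
  have hcontr : ContractingWith (1 / 2) (hmaps.restrict T B B) := by
    refine ⟨by norm_num, LipschitzWith.of_dist_le_mul ?_⟩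
    rintro ⟨z, hz⟩ ⟨w, hw⟩
    simp only [Subtype.dist_eq, Set.MapsTo.val_restrict_apply, dist_eq_norm, hT]
    rw [← sub_div, norm_div, hI, div_le_iff₀ hS0, neg_sub_neg, norm_sub_rev]
    have := hN_lip z hz w hw
    push_cast
    linarith
  obtain ⟨z, -, hz, -⟩ := ContractingWith.exists_fixedPoint' Metric.isClosed_closedBall.isComplete
    hmaps hcontr (x := 0) (by simp [hB]) (edist_ne_top _ _)
  refine ⟨z, ?_⟩
  rw [hfN]
  have h1 : -N z / (Complex.I * S 0) = z := hz
  rw [div_eq_iff hI0] at h1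
  linear_combination -h1

/-- A finite family of small nonnegative weights splits into four classes of nearly equal weight. -/
lemma exists_balanced_colouring {ι : Type*} [DecidableEq ι] (s : Finset ι) (w : ι → ℝ) {c : ℝ}
    (hc : 0 ≤ c) (hw : ∀ i, 0 ≤ w i) (hwc : ∀ i, w i ≤ c) :
    ∃ f : ι → Fin 4, ∀ j k,
      |∑ i ∈ s with f i = j, w i - ∑ i ∈ s with f i = k, w i| ≤ c := by
  induction s using Finset.induction_on with
  | empty => exact ⟨fun _ => 0, by simpa using hc⟩
  | insert a s ha ih =>
    obtain ⟨f, hf⟩ := ih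
    set W : Fin 4 → ℝ := fun j => ∑ i ∈ s with f i = j, w i with hW
    -- Greedy choice: the new weight joins the lightest class, which afterwards exceeds any other by
    -- at most `w a ≤ c`.
    obtain ⟨m, -, hm⟩ := Finset.exists_min_image Finset.univ W ⟨0, Finset.mem_univ _⟩
    have hnew : ∀ j, ∑ i ∈ insert a s with Function.update f a m i = j, w i =
        W j + if m = j then w a else 0 := by
      intro j
      have h1 : ∑ i ∈ s with Function.update f a m i = j, w i = W j := by
        refine Finset.sum_congr (Finset.filter_congr fun i hi => ?_) fun _ _ => rfl
        rw [Function.update_of_ne (by rintro rfl; exact ha hi)]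
      rw [Finset.filter_insert, Function.update_self]
      split_ifs
      · rw [Finset.sum_insert (by simp [ha]), h1, add_comm]
      · rw [h1, add_zero]
    refine ⟨Function.update f a m, fun j k => ?_⟩
    rw [hnew, hnew, abs_le]
    have h1 := abs_le.1 (hf j k)
    have h2 := hm j (Finset.mem_univ _)
    have h3 := hm k (Finset.mem_univ _)
    have h4 := hw a
    have h5 := hwc a
    change -c ≤ W j - W k ∧ W j - W k ≤ c at h1
    constructor <;> split_ifs with h6 h7 h7 <;> subst_vars <;> linarith [h1.1, h1.2]

/-! ### The identity a(p) = b(p). -/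

/-- The coefficients of `log L` as an arithmetic function. -/
noncomputable def logCoeff (b : ℕ → ℂ) (n : ℕ) : ℂ := by
  classical exact if IsPrimePow n then b n else 0

lemma term_logCoeff (b : ℕ → ℂ) (s : ℂ) (q : Nat.Primes × ℕ) :
    LSeries.term (logCoeff b) s (Nat.Primes.prodNatEquiv q : ℕ) = logTerm b 1 s q := by
  obtain ⟨p, k⟩ := q
  have hp : ((p : ℕ) : ℂ) ≠ 0 := by exact_mod_cast p.2.ne_zero
  have h1 : IsPrimePow ((p : ℕ) ^ (k + 1)) := p.2.isPrimePow.pow k.succ_ne_zero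
  rw [Nat.Primes.prodNatEquiv_apply, LSeries.term_of_ne_zero (pow_ne_zero _ p.2.ne_zero)]
  simp only [logCoeff, if_pos h1, logTerm, Pi.one_apply, Circle.coe_one, one_mul]
  rw [Complex.cpow_neg, inv_pow, div_eq_mul_inv, Nat.cast_pow,
    ← Complex.natCast_cpow_natCast_mul, Complex.cpow_nat_mul]

lemma injective_prodNatEquiv_coe :
    Function.Injective fun q : Nat.Primes × ℕ => (Nat.Primes.prodNatEquiv q : ℕ) :=
  Subtype.val_injective.comp Nat.Primes.prodNatEquiv.injective

lemma support_term_logCoeff (b : ℕ → ℂ) (s : ℂ) :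
    Function.support (LSeries.term (logCoeff b) s) ⊆
      Set.range fun q : Nat.Primes × ℕ => (Nat.Primes.prodNatEquiv q : ℕ) := by
  intro n hn
  by_cases h : IsPrimePow n
  · exact ⟨Nat.Primes.prodNatEquiv.symm ⟨n, h⟩, congrArg Subtype.val (Equiv.apply_symm_apply _ _)⟩
  · have h2 : logCoeff b n = 0 := if_neg h
    exact absurd (by simp [LSeries.term_def, h2]) hn

lemma summable_logCoeff {b : ℕ → ℂ} {s : ℂ} (h : Summable (logTerm b 1 s)) :
    LSeriesSummable (logCoeff b) s := by
  refine (injective_prodNatEquiv_coe.summable_iff fun n hn => ?_).1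
    (h.congr fun q => (term_logCoeff b s q).symm)
  exact Function.notMem_support.1 fun h => hn (support_term_logCoeff b s h)

lemma LSeries_logCoeff (b : ℕ → ℂ) (s : ℂ) : LSeries (logCoeff b) s = logSeries b 1 s := by
  unfold LSeries logSeries
  rw [← injective_prodNatEquiv_coe.tsum_eq (support_term_logCoeff b s)]
  exact tsum_congr fun q => term_logCoeff b s q

open LSeries LSeries.notation in
/-- The coefficients of a Dirichlet series and of its logarithm agree at the primes. -/
lemma coeff_prime_eq {a b : ℕ → ℂ} (ha : ∀ s : ℂ, 1 < s.re → LSeriesSummable a s)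
    (hb : ∀ σ : ℝ, 1 < σ → Summable (logMajorant b σ))
    (hexp : ∀ s : ℂ, 1 < s.re → Complex.exp (logSeries b 1 s) = LSeries a s)
    {p : ℕ} (hp : p.Prime) : a p = b p := by
  have hca : abscissaOfAbsConv a ≤ (1 : ℝ) :=
    abscissaOfAbsConv_le_of_forall_lt_LSeriesSummable fun y hy => ha y (by simpa using hy)
  have hcl : abscissaOfAbsConv (logCoeff b) ≤ (1 : ℝ) :=
    abscissaOfAbsConv_le_of_forall_lt_LSeriesSummable fun y hy =>
      summable_logCoeff (summable_logTerm hb 1 (by simpa using hy))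
  have hlt : ((1 : ℝ) : EReal) < ⊤ := EReal.coe_lt_top 1
  have ha1 : a 1 = 1 := by
    have h1 := LSeries.tendsto_atTop (hca.trans_lt hlt)
    have h2 : Tendsto (fun σ : ℝ => Complex.exp (logSeries b 1 σ)) atTop (𝓝 (Complex.exp 0)) :=
      (Complex.continuous_exp.tendsto 0).comp (tendsto_logSeries hb 1)
    rw [Complex.exp_zero] at h2
    refine tendsto_nhds_unique h1 (h2.congr' ?_)
    filter_upwards [eventually_gt_atTop 1] with σ hσ
    exact hexp _ (by simpa using hσ)
  have habs : ∀ {f : ℕ → ℂ} {s : ℂ}, abscissaOfAbsConv f ≤ (1 : ℝ) → 1 < s.re →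
      abscissaOfAbsConv f < s.re := fun h1 h2 =>
    h1.trans_lt (by exact_mod_cast h2)
  -- L' = L · (log L)' as Dirichlet series. At p the convolution reduces to a(1) b(p) log p, since
  -- log 1 = 0.
  have hderiv : ∀ s : ℂ, 1 < s.re →
      LSeries (logMul a) s = LSeries (a ⍟ logMul (logCoeff b)) s := by
    intro s hs
    have h1 := LSeries_hasDerivAt (habs hca hs)
    have h2 := (LSeries_hasDerivAt (habs hcl hs)).cexp
    have h3 : LSeries a =ᶠ[𝓝 s] fun z => Complex.exp (LSeries (logCoeff b) z) := by
      filter_upwards [(isOpen_lt continuous_const Complex.continuous_re).mem_nhds hs] with z hz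
      rw [LSeries_logCoeff, hexp z hz]
    have h4 := (h1.congr_of_eventuallyEq h3.symm).unique h2
    rw [LSeries_logCoeff, hexp s hs] at h4
    rw [LSeries_convolution' (ha s hs) (LSeriesSummable_logMul_of_lt_re (habs hcl hs))]
    linear_combination -h4
  have hcm : abscissaOfAbsConv (logMul (logCoeff b)) ≤ (1 : ℝ) := by
    rwa [abscissaOfAbsConv_logMul]
  have hkey : logMul a p = (a ⍟ logMul (logCoeff b)) p := by
    refine LSeries.eq_of_LSeries_eventually_eq
      (by rw [abscissaOfAbsConv_logMul]; exact hca.trans_lt hlt) ?_ ?_ hp.ne_zero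
    · refine (abscissaOfAbsConv_convolution_le _ _).trans_lt ?_
      exact max_lt (hca.trans_lt hlt) (hcm.trans_lt hlt)
    · filter_upwards [eventually_gt_atTop 1] with σ hσ
      exact hderiv σ (by simpa using hσ)
  rw [convolution_def] at hkey
  beta_reduce at hkey
  rw [Nat.sum_divisorsAntidiagonal fun i j => a i * logMul (logCoeff b) j, hp.divisors] at hkey
  have hlog : Complex.log p ≠ 0 := by
    rw [← Complex.natCast_log]
    exact_mod_cast (Real.log_pos (by exact_mod_cast hp.one_lt)).ne'
  have hlp : logCoeff b p = b p := if_pos hp.isPrimePow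
  rw [Finset.sum_insert (by simp [hp.one_lt.ne'.symm]), Finset.sum_singleton, Nat.div_one,
    Nat.div_self hp.pos] at hkey
  simp [logMul, ha1, hlp] at hkey
  rcases hkey with h | h
  · exact h
  · exact absurd h (by simpa using hlog)

/-! ### The tail and its dependence on the twist. -/

/-- The sum `L(2s) + ⋯ + L(Ns)`, twisted by `u`. -/
noncomputable def twistedTail (b : ℕ → ℂ) (N : ℕ) (u : Nat.Primes → Circle) (s : ℂ) : ℂ :=
  ∑ m ∈ Finset.Icc 2 N, Complex.exp (logSeries b (u ^ m) (m * s))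

/-- This is why the tail stays holomorphic across the line Re s = 1, where L itself need not. -/
lemma one_lt_re_natCast_mul {m : ℕ} (hm : 2 ≤ m) {s : ℂ} (hs : 1 / 2 < s.re) :
    1 < ((m : ℂ) * s).re := by
  have h : ((m : ℂ) * s).re = m * s.re := by simp
  have hm' : (2 : ℝ) ≤ m := by exact_mod_cast hm
  rw [h]
  nlinarith

section
variable {b : ℕ → ℂ} (hb : ∀ σ : ℝ, 1 < σ → Summable (logMajorant b σ))
include hb

lemma continuousAt_logSeries_pow {x : (Nat.Primes → Circle) × ℂ} {m : ℕ}
    (hx : 1 < ((m : ℂ) * x.2).re) :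
    ContinuousAt (fun x : (Nat.Primes → Circle) × ℂ => logSeries b (x.1 ^ m) (m * x.2)) x := by
  have h : Continuous fun x : (Nat.Primes → Circle) × ℂ => (x.1 ^ m, (m : ℂ) * x.2) := by fun_prop
  exact ContinuousAt.comp (f := fun x : (Nat.Primes → Circle) × ℂ => (x.1 ^ m, (m : ℂ) * x.2))
    (g := fun x : (Nat.Primes → Circle) × ℂ => logSeries b x.1 x.2)
    (continuousAt_logSeries hb hx) h.continuousAt

lemma continuousAt_twistedTail (N : ℕ) {x : (Nat.Primes → Circle) × ℂ} (hx : 1 / 2 < x.2.re) :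
    ContinuousAt (fun x : (Nat.Primes → Circle) × ℂ => twistedTail b N x.1 x.2) x := by
  unfold twistedTail
  refine tendsto_finsetSum _ fun m hm => ?_
  exact (continuousAt_logSeries_pow hb
    (one_lt_re_natCast_mul (Finset.mem_Icc.1 hm).1 hx)).cexp

lemma differentiableAt_twistedTail (N : ℕ) (u : Nat.Primes → Circle) {s : ℂ} (hs : 1 / 2 < s.re) :
    DifferentiableAt ℂ (twistedTail b N u) s := by
  unfold twistedTail
  refine DifferentiableAt.fun_sum fun m hm => DifferentiableAt.cexp ?_
  exact DifferentiableAt.comp (g := logSeries b (u ^ m)) s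
    (differentiableAt_logSeries hb _ (one_lt_re_natCast_mul (Finset.mem_Icc.1 hm).1 hs))
    (by fun_prop)

lemma tendsto_twistedTail (N : ℕ) (u : Nat.Primes → Circle) :
    Tendsto (fun σ : ℝ => twistedTail b N u σ) atTop (𝓝 ((N - 1 : ℕ) : ℂ)) := by
  have h : ((N - 1 : ℕ) : ℂ) = ∑ m ∈ Finset.Icc 2 N, Complex.exp 0 := by
    simp
  rw [h]
  refine tendsto_finsetSum _ fun m hm => ?_
  have hm2 : 2 ≤ m := (Finset.mem_Icc.1 hm).1
  have h1 : Tendsto (fun σ : ℝ => (m : ℝ) * σ) atTop atTop :=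
    tendsto_id.const_mul_atTop (by positivity)
  have h2 := (Complex.continuous_exp.tendsto 0).comp ((tendsto_logSeries hb (u ^ m)).comp h1)
  refine h2.congr fun σ => ?_
  simp [Function.comp]

/-- On the line `Re s = 1` the sum `L(2s) + ⋯ + L(Ns)` does not vanish identically. -/
lemma exists_twistedTail_primeFlow_ne_zero {N : ℕ} (hN : 2 ≤ N) :
    ∃ t : ℝ, twistedTail b N (primeFlow t) 1 ≠ 0 := by
  by_contra! hall
  -- Twisting by the flow at s = 1 gives the untwisted tail at 1 + it. Vanishing on that line would
  -- force the tail to vanish identically, against its limit N - 1 at +∞.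
  have h1 : ∀ t : ℝ, twistedTail b N 1 (1 + t * Complex.I) = 0 := by
    intro t
    rw [← hall t]
    unfold twistedTail
    refine Finset.sum_congr rfl fun m _ => ?_
    rw [logSeries_primeFlow_pow, one_pow]
  set U : Set ℂ := {s | 1 / 2 < s.re} with hU
  have hUo : IsOpen U := isOpen_lt continuous_const Complex.continuous_re
  have hUc : IsPreconnected U := (convex_halfSpace_re_gt _).isPreconnected
  have han : AnalyticOnNhd ℂ (twistedTail b N 1) U :=
    DifferentiableOn.analyticOnNhd (fun s hs =>
      (differentiableAt_twistedTail hb N 1 hs).differentiableWithinAt) hUo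
  have hfreq : ∃ᶠ z in 𝓝[≠] (1 : ℂ), twistedTail b N 1 z = 0 := by
    have ht : Tendsto (fun t : ℝ => 1 + (t : ℂ) * Complex.I) (𝓝[≠] 0) (𝓝[≠] 1) := by
      refine tendsto_nhdsWithin_iff.2 ⟨?_, ?_⟩
      · have hc : Continuous fun t : ℝ => 1 + (t : ℂ) * Complex.I := by fun_prop
        simpa using (hc.tendsto 0).mono_left nhdsWithin_le_nhds
      · filter_upwards [self_mem_nhdsWithin] with t ht
        simpa using ht
    exact ht.frequently (Eventually.of_forall h1).frequently
  have hzero := han.eqOn_zero_of_preconnected_of_frequently_eq_zero hUc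
    (show (1 : ℂ) ∈ U by norm_num [hU]) hfreq
  have hlim := tendsto_twistedTail hb N 1
  have hlim0 : Tendsto (fun σ : ℝ => twistedTail b N 1 σ) atTop (𝓝 0) := by
    refine tendsto_const_nhds.congr' ?_
    filter_upwards [eventually_gt_atTop 1] with σ hσ
    have hσU : (σ : ℂ) ∈ U := by
      simp only [hU, Set.mem_ofPred_eq, Complex.ofReal_re]
      linarith
    exact (hzero hσU).symm
  have h2 := tendsto_nhds_unique hlim hlim0
  have h3 : N - 1 = 0 := by exact_mod_cast h2
  omega

end

lemma norm_exp_sub_exp_le {D : ℝ} {x y : ℂ} (hx : ‖x‖ ≤ D) (hy : ‖y‖ ≤ D) :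
    ‖Complex.exp x - Complex.exp y‖ ≤ Real.exp D * ‖x - y‖ := by
  refine (convex_closedBall (0 : ℂ) D).norm_image_sub_le_of_norm_hasDerivWithin_le
    (f := Complex.exp) (f' := Complex.exp) (fun z _ => (Complex.hasDerivAt_exp z).hasDerivWithinAt)
    (fun z hz => ?_) (by simpa using hy) (by simpa using hx)
  rw [Complex.norm_exp]
  exact Real.exp_le_exp.2 ((Complex.re_le_norm z).trans (by simpa using hz))

lemma norm_log_sub_log_le {x y : ℂ} (hx : ‖x - 1‖ ≤ 1 / 2) (hy : ‖y - 1‖ ≤ 1 / 2) :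
    ‖Complex.log x - Complex.log y‖ ≤ 2 * ‖x - y‖ := by
  have hre : ∀ z ∈ Metric.closedBall (1 : ℂ) (1 / 2), 1 / 2 ≤ z.re := by
    intro z hz
    rw [Metric.mem_closedBall, dist_eq_norm] at hz
    have h1 := (abs_le.1 ((Complex.abs_re_le_norm _).trans hz)).1
    simp only [Complex.sub_re, Complex.one_re] at h1
    linarith
  refine (convex_closedBall (1 : ℂ) (1 / 2)).norm_image_sub_le_of_norm_hasDerivWithin_le
    (f := Complex.log) (f' := fun z => z⁻¹)
    (fun z hz => (Complex.hasDerivAt_log (Or.inl ?_)).hasDerivWithinAt)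
    (fun z hz => ?_) (by simpa [dist_eq_norm] using hy) (by simpa [dist_eq_norm] using hx)
  · linarith [hre z hz]
  · have h1 := (hre z hz).trans (Complex.re_le_norm z)
    rw [norm_inv]
    exact inv_le_of_inv_le₀ (by norm_num) (by linarith)

/-- `L(2s) + ⋯ + L(Ns)` is Lipschitz in the twist, uniformly for `Re s ≥ 1`. -/
lemma exists_twistedTail_lipschitz {b : ℕ → ℂ}
    (h2 : Summable fun q : Nat.Primes × ℕ => ((q.2 : ℝ) + 1) * logMajorant b 2 q) (N : ℕ) :
    ∃ C : ℝ, 0 ≤ C ∧ ∀ (u v : Nat.Primes → Circle) (d : ℝ), (∀ p, ‖(u p : ℂ) - v p‖ ≤ d) →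
      ∀ s : ℂ, 1 ≤ s.re → ‖twistedTail b N u s - twistedTail b N v s‖ ≤ C * d := by
  -- Every argument ms has real part at least 2, so `D` bounds each log series and its Lipschitz
  -- constant. The exponential costs e^D, the power u^m a factor m.
  set D := ∑' q : Nat.Primes × ℕ, ((q.2 : ℝ) + 1) * logMajorant b 2 q with hD
  have hD0 : 0 ≤ D := tsum_nonneg fun q => mul_nonneg (by positivity) (logMajorant_nonneg _ _ _)
  have hmaj : ∀ {s : ℂ}, 2 ≤ s.re → ∀ q, ((q.2 : ℝ) + 1) * logMajorant b s.re q ≤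
      ((q.2 : ℝ) + 1) * logMajorant b 2 q := fun hs q =>
    mul_le_mul_of_nonneg_left (logMajorant_anti b hs q) (by positivity)
  have hterm : ∀ {s : ℂ}, 2 ≤ s.re → ∀ (u : Nat.Primes → Circle) q, ‖logTerm b u s q‖ ≤
      ((q.2 : ℝ) + 1) * logMajorant b 2 q := by
    intro s hs u q
    rw [norm_logTerm]
    refine le_trans ?_ (hmaj hs q)
    refine le_mul_of_one_le_left (logMajorant_nonneg _ _ _) ?_
    linarith [(Nat.cast_nonneg q.2 : (0 : ℝ) ≤ q.2)]
  have hbd : ∀ {s : ℂ}, 2 ≤ s.re → ∀ u : Nat.Primes → Circle, ‖logSeries b u s‖ ≤ D :=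
    fun hs u => tsum_of_norm_bounded h2.hasSum (hterm hs u)
  have hlip : ∀ {s : ℂ}, 2 ≤ s.re → ∀ (u v : Nat.Primes → Circle) (d : ℝ),
      (∀ p, ‖(u p : ℂ) - v p‖ ≤ d) → ‖logSeries b u s - logSeries b v s‖ ≤ D * d := by
    intro s hs u v d hd
    unfold logSeries
    rw [← (Summable.of_norm_bounded h2 (hterm hs u)).tsum_sub
      (Summable.of_norm_bounded h2 (hterm hs v))]
    refine tsum_of_norm_bounded (h2.hasSum.mul_right d) fun q => ?_
    refine (norm_logTerm_sub_le b u v s q).trans ?_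
    exact mul_le_mul (hmaj hs q) (hd q.1) (norm_nonneg _)
      (mul_nonneg (by positivity) (logMajorant_nonneg _ _ _))
  refine ⟨∑ m ∈ Finset.Icc 2 N, Real.exp D * (D * m), by positivity, fun u v d hd s hs => ?_⟩
  unfold twistedTail
  rw [← Finset.sum_sub_distrib, Finset.sum_mul]
  refine norm_sum_le_of_le _ fun m hm => ?_
  have hm2 : (2 : ℝ) ≤ m := by exact_mod_cast (Finset.mem_Icc.1 hm).1
  have hs2 : 2 ≤ ((m : ℂ) * s).re := by
    have h : ((m : ℂ) * s).re = m * s.re := by simp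
    rw [h]; nlinarith
  refine (norm_exp_sub_exp_le (hbd hs2 _) (hbd hs2 _)).trans ?_
  rw [mul_assoc, mul_assoc]
  refine mul_le_mul_of_nonneg_left (hlip hs2 _ _ _ fun p => ?_) (Real.exp_pos _).le
  exact (norm_circle_pow_sub_le (u p) (v p) m).trans
    (mul_le_mul_of_nonneg_left (hd p) (by positivity))

/-! ### The logarithm after removal of finitely many prime terms. -/

section
variable {b : ℕ → ℂ} (hb : ∀ σ : ℝ, 1 < σ → Summable (logMajorant b σ))
  (h1 : Summable fun q : Nat.Primes × ℕ =>
    if q.2 < 1 then 0 else ((q.2 : ℝ) + 1) * logMajorant b 1 q)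
include hb

lemma logSeries_sub_sum (u : Nat.Primes → Circle) {σ : ℝ} (hσ : 1 < σ) (Q : Finset Nat.Primes) :
    logSeries b u σ - ∑ p ∈ Q, logTerm b u σ (p, 0) =
      ∑' q : Nat.Primes × ℕ, if q.2 = 0 ∧ q.1 ∈ Q then 0 else logTerm b u σ q := by
  classical
  have hs := summable_logTerm hb u (s := σ) (by simpa using hσ)
  have hinj : Function.Injective fun p : Nat.Primes => (p, (0 : ℕ)) := fun p p' h => by
    simpa using h
  have h2 : ∑ p ∈ Q, logTerm b u σ (p, 0) =
      ∑' q : Nat.Primes × ℕ, if q.2 = 0 ∧ q.1 ∈ Q then logTerm b u σ q else 0 := by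
    rw [tsum_eq_sum (s := Q.map ⟨_, hinj⟩)]
    · rw [Finset.sum_map]
      refine Finset.sum_congr rfl fun p hp => ?_
      simp [hp]
    · rintro ⟨p, k⟩ hq
      rw [if_neg]
      rintro ⟨rfl, hp⟩
      exact hq (by simpa using hp)
  have hs2 : Summable fun q : Nat.Primes × ℕ =>
      if q.2 = 0 ∧ q.1 ∈ Q then logTerm b u σ q else 0 := by
    refine Summable.of_norm_bounded hs.norm fun q => ?_
    split_ifs <;> simp
  rw [h2, logSeries, ← hs.tsum_sub hs2]
  refine tsum_congr fun q => ?_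
  split_ifs <;> simp

include h1

/-- The terms with k ≥ 2 converge absolutely already at σ = 1, so their contribution is bounded
uniformly in σ and u. -/
lemma norm_logSeries_sub_sum_le (u : Nat.Primes → Circle) {σ : ℝ} (hσ : 1 < σ)
    (Q : Finset Nat.Primes) :
    ‖logSeries b u σ - ∑ p ∈ Q, logTerm b u σ (p, 0)‖ ≤
      (∑' p : Nat.Primes, logMajorant b σ (p, 0) - ∑ p ∈ Q, logMajorant b σ (p, 0)) +
      ∑' q : Nat.Primes × ℕ, if q.2 < 1 then 0 else ((q.2 : ℝ) + 1) * logMajorant b 1 q := by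
  classical
  rw [logSeries_sub_sum hb u hσ]
  have hinj : Function.Injective fun p : Nat.Primes => (p, (0 : ℕ)) := fun p p' h => by
    simpa using h
  have hw : Summable fun p : Nat.Primes => logMajorant b σ (p, 0) :=
    (hb σ hσ).comp_injective hinj
  have h2 : HasSum (fun p : Nat.Primes => if p ∈ Q then 0 else logMajorant b σ (p, 0))
      (∑' p : Nat.Primes, logMajorant b σ (p, 0) - ∑ p ∈ Q, logMajorant b σ (p, 0)) := by
    have h3 : HasSum (fun p : Nat.Primes => if p ∈ Q then logMajorant b σ (p, 0) else 0)
        (∑ p ∈ Q, logMajorant b σ (p, 0)) := by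
      have : HasSum (fun p : Nat.Primes => if p ∈ Q then logMajorant b σ (p, 0) else 0)
          (∑ p ∈ Q, if p ∈ Q then logMajorant b σ (p, 0) else 0) :=
        hasSum_sum_of_ne_finset_zero fun p hp => if_neg hp
      rwa [Finset.sum_congr rfl fun p hp => if_pos hp] at this
    have h := hw.hasSum.sub h3
    rwa [show (fun p : Nat.Primes => logMajorant b σ (p, 0) -
      if p ∈ Q then logMajorant b σ (p, 0) else 0) =
      fun p => if p ∈ Q then 0 else logMajorant b σ (p, 0) from
        funext fun p => by split_ifs <;> simp] at h
  have h4 : HasSum (fun q : Nat.Primes × ℕ =>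
      if q.2 = 0 then (if q.1 ∈ Q then 0 else logMajorant b σ (q.1, 0)) else 0)
      (∑' p : Nat.Primes, logMajorant b σ (p, 0) - ∑ p ∈ Q, logMajorant b σ (p, 0)) := by
    refine (hinj.hasSum_iff fun q hq => ?_).1 (by simpa [Function.comp_def] using h2)
    rw [if_neg]
    rintro h
    exact hq ⟨q.1, Prod.ext rfl h.symm⟩
  refine tsum_of_norm_bounded (h4.add h1.hasSum) ?_
  rintro ⟨p, k⟩
  rcases Nat.eq_zero_or_pos k with rfl | hk
  · by_cases hp : p ∈ Q <;> simp [hp, norm_logTerm]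
  · have h5 : ¬ k < 1 := by omega
    simp only [hk.ne', false_and, if_false, h5, zero_add, norm_logTerm, Complex.ofReal_re]
    refine (logMajorant_anti b hσ.le (p, k)).trans ?_
    exact le_mul_of_one_le_left (logMajorant_nonneg _ _ _)
      (by linarith [(Nat.cast_nonneg k : (0 : ℝ) ≤ k)])

/-- First-order terms outside `Q` cancel, so only k ≥ 2 contributes and the Lipschitz constant does
not grow as σ → 1⁺. -/
lemma norm_logSeries_sub_sum_sub_le (u v : Nat.Primes → Circle) {σ d : ℝ} (hσ : 1 < σ)
    (Q : Finset Nat.Primes) (hQ : ∀ p ∉ Q, u p = v p) (hd : ∀ p, ‖(u p : ℂ) - v p‖ ≤ d) :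
    ‖(logSeries b u σ - ∑ p ∈ Q, logTerm b u σ (p, 0)) -
      (logSeries b v σ - ∑ p ∈ Q, logTerm b v σ (p, 0))‖ ≤
      (∑' q : Nat.Primes × ℕ, if q.2 < 1 then 0 else ((q.2 : ℝ) + 1) * logMajorant b 1 q) * d := by
  classical
  rw [logSeries_sub_sum hb u hσ, logSeries_sub_sum hb v hσ]
  have hs : ∀ u : Nat.Primes → Circle, Summable fun q : Nat.Primes × ℕ =>
      if q.2 = 0 ∧ q.1 ∈ Q then 0 else logTerm b u σ q := by
    intro u
    refine Summable.of_norm_bounded (summable_logTerm hb u (s := σ) (by simpa using hσ)).norm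
      fun q => ?_
    split_ifs <;> simp
  rw [← (hs u).tsum_sub (hs v)]
  refine tsum_of_norm_bounded (h1.hasSum.mul_right d) ?_
  rintro ⟨p, k⟩
  rcases Nat.eq_zero_or_pos k with rfl | hk
  · by_cases hp : p ∈ Q
    · simp [hp]
    · simp [hp, logTerm, hQ p hp]
  · have h5 : ¬ k < 1 := by omega
    simp only [hk.ne', false_and, if_false, h5]
    refine (norm_logTerm_sub_le b u v σ (p, k)).trans ?_
    rw [Complex.ofReal_re]
    refine mul_le_mul ?_ (hd p) (norm_nonneg _)
      (mul_nonneg (by positivity) (logMajorant_nonneg _ _ _))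
    exact mul_le_mul_of_nonneg_left (logMajorant_anti b hσ.le (p, k)) (by positivity)

end

/-! ### Construction of a twist with a zero. -/

/-- Unit vectors near `1, I, -1, -I`; the first two are rotated by the coordinates of `z`. -/
noncomputable def quarterTurn (z : ℂ) : Fin 4 → Circle :=
  ![Circle.exp z.re, Circle.exp (Real.pi / 2 + z.im), Circle.exp Real.pi,
    Circle.exp (-(Real.pi / 2))]

lemma sum_mul_quarterTurn (S : Fin 4 → ℝ) (z : ℂ) :
    ∑ j, (S j : ℂ) * (quarterTurn z j : ℂ) = S 0 * Complex.exp (z.re * Complex.I) +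
      S 1 * (Complex.I * Complex.exp (z.im * Complex.I)) - S 2 - S 3 * Complex.I := by
  have h1 : Complex.exp (((Real.pi / 2 + z.im : ℝ) : ℂ) * Complex.I) =
      Complex.I * Complex.exp (z.im * Complex.I) := by
    push_cast
    rw [add_mul, Complex.exp_add, Complex.exp_pi_div_two_mul_I]
  have h2 : Complex.exp (((-(Real.pi / 2) : ℝ) : ℂ) * Complex.I) = -Complex.I := by
    push_cast
    rw [neg_mul, Complex.exp_neg, Complex.exp_pi_div_two_mul_I, Complex.inv_I]
  simp only [Fin.sum_univ_four, quarterTurn, Matrix.cons_val, Circle.coe_exp, h1, h2,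
    Complex.exp_pi_mul_I]
  ring

lemma norm_quarterTurn_sub_le (z w : ℂ) (j : Fin 4) :
    ‖(quarterTurn z j : ℂ) - quarterTurn w j‖ ≤ ‖z - w‖ := by
  have hre : |z.re - w.re| ≤ ‖z - w‖ := by simpa using Complex.abs_re_le_norm (z - w)
  have him : |z.im - w.im| ≤ ‖z - w‖ := by simpa using Complex.abs_im_le_norm (z - w)
  fin_cases j
  · simpa [quarterTurn, Circle.coe_exp] using (norm_exp_mul_I_sub_le _ _).trans hre
  · have h := norm_exp_mul_I_sub_le (Real.pi / 2 + z.im) (Real.pi / 2 + w.im)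
    rw [add_sub_add_left_eq_sub] at h
    change ‖(Circle.exp (Real.pi / 2 + z.im) : ℂ) - Circle.exp (Real.pi / 2 + w.im)‖ ≤ _
    rw [Circle.coe_exp, Circle.coe_exp]
    exact h.trans him
  · simp [quarterTurn]
  · simp [quarterTurn]

lemma exists_circle_mul_eq_norm (x : ℂ) : ∃ c : Circle, x * c = ‖x‖ := by
  refine ⟨Circle.exp (-x.arg), ?_⟩
  rw [Circle.coe_exp]
  conv_lhs => rw [← Complex.norm_mul_exp_arg_mul_I x]
  rw [mul_assoc, ← Complex.exp_add]
  simp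

/-- Some twist of `L(s) + L(2s) + ⋯ + L(Ns)` has a zero with `Re s > 1`. -/
theorem exists_twist_eq_zero {b : ℕ → ℂ} {K θ : ℝ}
    (hb : ∀ σ : ℝ, 1 < σ → Summable (logMajorant b σ)) (hK : 0 < K) (hθ : θ < 1 / 2)
    (hbound : ∀ p : ℕ, p.Prime → ∀ k : ℕ, 1 ≤ k → ‖b (p ^ k)‖ ≤ K * (p : ℝ) ^ ((k : ℝ) * θ))
    (hdiv : Tendsto (fun σ : ℝ => ∑' p : Nat.Primes, logMajorant b σ (p, 0)) (𝓝[>] (1 : ℝ)) atTop)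
    {N : ℕ} (hN : 2 ≤ N) :
    ∃ σ : ℝ, 1 < σ ∧ ∃ u : Nat.Primes → Circle,
      Complex.exp (logSeries b u σ) + twistedTail b N u σ = 0 := by
  classical
  have hs1 := summable_weighted_logMajorant hK hθ hbound le_rfl 1 (by norm_num; linarith)
  have hs2 : Summable fun q : Nat.Primes × ℕ => ((q.2 : ℝ) + 1) * logMajorant b 2 q := by
    simpa using summable_weighted_logMajorant hK hθ hbound (σ := 2) (by norm_num) 0
      (by norm_num; linarith)
  set D := ∑' q : Nat.Primes × ℕ, if q.2 < 1 then 0 else ((q.2 : ℝ) + 1) * logMajorant b 1 q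
    with hD
  have hD0 : 0 ≤ D := tsum_nonneg fun q => by
    split_ifs
    · exact le_rfl
    · exact mul_nonneg (by positivity) (logMajorant_nonneg _ _ _)
  obtain ⟨CT, hCT0, hCT⟩ := exists_twistedTail_lipschitz hs2 N
  obtain ⟨t, ht⟩ := exists_twistedTail_primeFlow_ne_zero hb hN
  set u₀ := primeFlow t with hu₀
  set g₀ := twistedTail b N u₀ 1 with hg₀
  have hg₀n : 0 < ‖g₀‖ := norm_pos_iff.2 ht
  -- the tail stays near `g₀` once finitely many coordinates are fixed
  have hnear : ∀ᶠ x in 𝓝 (u₀, (1 : ℂ)), ‖twistedTail b N x.1 x.2 - g₀‖ < ‖g₀‖ / 2 := by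
    have hc := continuousAt_twistedTail hb N (x := (u₀, (1 : ℂ))) (by norm_num)
    have h := hc.eventually (Metric.ball_mem_nhds _ (half_pos hg₀n))
    simpa [dist_eq_norm] using h
  rw [nhds_prod_eq] at hnear
  obtain ⟨P, hP, V, hV, hPV⟩ := eventually_prod_iff.1 hnear
  have hP' : {u | P u} ∈ 𝓝 u₀ := hP
  rw [nhds_pi, Filter.mem_pi] at hP'
  obtain ⟨I', hI', W, hW, hWP⟩ := hP'
  set I := hI'.toFinset with hI
  have hPI : ∀ u : Nat.Primes → Circle, (∀ p ∈ I, u p = u₀ p) → P u := fun u hu =>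
    hWP fun p hp => by rw [hu p (hI'.mem_toFinset.2 hp)]; exact mem_of_mem_nhds (hW p)
  set CI := ∑ p ∈ I, logMajorant b 1 (p, 0) with hCI
  have hCI0 : 0 ≤ CI := Finset.sum_nonneg fun p _ => logMajorant_nonneg _ _ _
  -- One constant, fixed before σ, dominates every error: the remainder of log L, both logarithms of
  -- the tail, the Lipschitz constants and the imbalance `K` of the colouring.
  set C := D + 1 + CI + ‖Complex.log (-g₀)‖ + 1 + 2 * (CT / ‖g₀‖) + K with hC
  have hCT' : 0 ≤ CT / ‖g₀‖ := by positivity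
  have hC0 : 0 < C := by
    have := norm_nonneg (Complex.log (-g₀))
    linarith
  have hKC : K ≤ C := by
    have := norm_nonneg (Complex.log (-g₀))
    linarith
  have hVσ : ∀ᶠ σ : ℝ in 𝓝[>] 1, V σ := by
    have h : Tendsto (fun σ : ℝ => (σ : ℂ)) (𝓝[>] 1) (𝓝 1) := by
      simpa using (Complex.continuous_ofReal.tendsto 1).mono_left nhdsWithin_le_nhds
    exact h.eventually hV
  -- The weight on `Q` will be at least 405C - (1 + CI) ≥ 404C. Four classes within C of `S 0` then
  -- force 4 S₀ ≥ 401C, so S₀ ≥ 100C.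
  obtain ⟨σ, ⟨hVσ, hσbig⟩, hσ⟩ := ((hVσ.and (hdiv.eventually_ge_atTop (405 * C))).and
    self_mem_nhdsWithin).exists
  replace hσ : 1 < σ := hσ
  refine ⟨σ, hσ, ?_⟩
  set w : Nat.Primes → ℝ := fun p => logMajorant b σ (p, 0) with hw
  have hw0 : ∀ p, 0 ≤ w p := fun p => logMajorant_nonneg _ _ _
  have hwK : ∀ p, w p ≤ K := by
    intro p
    refine (logMajorant_le hbound σ (p, 0)).trans ?_
    have h1 : (1 : ℝ) ≤ ((p : ℕ) : ℝ) := by exact_mod_cast p.2.one_le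
    have h2 : ((p : ℕ) : ℝ) ^ (θ - σ) ≤ 1 := Real.rpow_le_one_of_one_le_of_nonpos h1 (by linarith)
    simpa using mul_le_mul_of_nonneg_left h2 hK.le
  have hwsum : Summable w := (hb σ hσ).comp_injective fun p p' h => by simpa using h
  obtain ⟨Q₀, hQ₀I, hQ₀⟩ : ∃ Q₀ : Finset Nat.Primes, I ⊆ Q₀ ∧ ∑' p, w p - 1 < ∑ p ∈ Q₀, w p :=
    ((eventually_ge_atTop I).and (hwsum.hasSum.eventually (lt_mem_nhds (sub_one_lt _)))).exists
  set Q := Q₀ \ I with hQ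
  have hQsum : ∑' p, w p - ∑ p ∈ Q, w p ≤ 1 + CI := by
    have h1 := Finset.sum_sdiff (f := w) hQ₀I
    have h2 : ∑ p ∈ I, w p ≤ CI := Finset.sum_le_sum fun p _ => logMajorant_anti b hσ.le _
    linarith
  obtain ⟨f, hf⟩ := exists_balanced_colouring Q w hK.le hw0 hwK
  set S : Fin 4 → ℝ := fun j => ∑ p ∈ Q with f p = j, w p with hS
  have hSK : ∀ j, |S j - S 0| ≤ C := fun j => (hf j 0).trans hKC
  have hStot : ∑ j, S j = ∑ p ∈ Q, w p := Finset.sum_fiberwise Q f w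
  have hS0 : 100 * C ≤ S 0 := by
    rw [Fin.sum_univ_four] at hStot
    have h1 := (abs_le.1 (hSK 1)).2
    have h2 := (abs_le.1 (hSK 2)).2
    have h3 := (abs_le.1 (hSK 3)).2
    have h4 := norm_nonneg (Complex.log (-g₀))
    linarith
  choose c hc using fun p : Nat.Primes => exists_circle_mul_eq_norm (logTerm b 1 σ (p, 0))
  -- Coordinates in `I` hold the tail near `g₀`. On `Q`, `c p` makes the prime term positive before
  -- it is turned to the direction of its colour.
  set u : ℂ → Nat.Primes → Circle := fun z p =>
    if p ∈ I then u₀ p else if p ∈ Q then c p * quarterTurn z (f p) else 1 with hu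
  have huI : ∀ z, ∀ p ∈ I, u z p = u₀ p := fun z p hp => if_pos hp
  have huQ : ∀ z, ∀ p ∈ Q, u z p = c p * quarterTurn z (f p) := fun z p hp => by
    simp only [hu]
    rw [if_neg (Finset.mem_sdiff.1 hp).2, if_pos hp]
  have hunQ : ∀ z z', ∀ p ∉ Q, u z p = u z' p := fun z z' p hp => by
    simp only [hu, if_neg hp]
  have hud : ∀ z z' p, ‖(u z p : ℂ) - u z' p‖ ≤ ‖z - z'‖ := by
    intro z z' p
    by_cases hp : p ∈ Q
    · rw [huQ z p hp, huQ z' p hp, Circle.coe_mul, Circle.coe_mul, ← mul_sub, norm_mul,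
        Circle.norm_coe, one_mul]
      exact norm_quarterTurn_sub_le z z' (f p)
    · rw [hunQ z z' p hp, sub_self, norm_zero]
      exact norm_nonneg _
  have hmain : ∀ z, ∑ p ∈ Q, logTerm b (u z) σ (p, 0) =
      ∑ j, (S j : ℂ) * (quarterTurn z j : ℂ) := by
    intro z
    have h1 : ∀ p ∈ Q, logTerm b (u z) σ (p, 0) = (w p : ℂ) * (quarterTurn z (f p) : ℂ) := by
      intro p hp
      have h2 := hc p
      rw [norm_logTerm, Complex.ofReal_re] at h2
      rw [hw, ← h2]
      simp only [logTerm, huQ z p hp, Circle.coe_mul, Pi.one_apply, Circle.coe_one]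
      ring
    rw [Finset.sum_congr rfl h1, ← Finset.sum_fiberwise Q f]
    refine Finset.sum_congr rfl fun j _ => ?_
    simp only [hS]
    push_cast
    rw [Finset.sum_mul]
    refine Finset.sum_congr rfl fun p hp => ?_
    rw [(Finset.mem_filter.1 hp).2]
  set R : ℂ → ℂ := fun z => logSeries b (u z) σ - ∑ p ∈ Q, logTerm b (u z) σ (p, 0) with hR
  set G : ℂ → ℂ := fun z => twistedTail b N (u z) σ / g₀ with hG
  have hG1 : ∀ z, ‖G z - 1‖ ≤ 1 / 2 := by
    intro z
    have h1 := hPV (hPI (u z) (huI z)) hVσ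
    simp only at h1
    have h2 : G z - 1 = (twistedTail b N (u z) σ - g₀) / g₀ := by
      simp only [hG]; rw [sub_div, div_self ht]
    rw [h2, norm_div, div_le_iff₀ hg₀n]
    linarith
  have hGL : ∀ z z', ‖G z - G z'‖ ≤ CT / ‖g₀‖ * ‖z - z'‖ := by
    intro z z'
    simp only [hG]
    rw [← sub_div, norm_div, div_mul_eq_mul_div]
    gcongr
    exact hCT _ _ _ (hud z z') σ (by simpa using hσ.le)
  have hlog1 : ∀ z, ‖Complex.log (G z)‖ ≤ 1 := by
    intro z
    have h1 := norm_log_sub_log_le (hG1 z) (show ‖(1 : ℂ) - 1‖ ≤ 1 / 2 by norm_num)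
    rw [Complex.log_one, sub_zero] at h1
    linarith [hG1 z]
  -- The equation is log L = log(-g₀) + log G. Since G is within 1/2 of 1, its principal logarithm
  -- is bounded and Lipschitz in z.
  obtain ⟨z, hz⟩ := exists_angles_eq_zero S
    (fun z => R z - Complex.log (-g₀) - Complex.log (G z)) hC0 hSK hS0
    (fun z _ => by
      have h1 := norm_logSeries_sub_sum_le hb hs1 (u z) hσ Q
      have h2 := norm_sub_le (R z - Complex.log (-g₀)) (Complex.log (G z))
      have h3 := norm_sub_le (R z) (Complex.log (-g₀))
      have h4 := hlog1 z
      change ‖R z‖ ≤ (∑' p, w p - ∑ p ∈ Q, w p) + D at h1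
      linarith)
    (fun z _ z' _ => by
      have h1 := norm_logSeries_sub_sum_sub_le hb hs1 (u z) (u z') hσ Q (hunQ z z') (hud z z')
      have h2 := (norm_log_sub_log_le (hG1 z) (hG1 z')).trans
        (mul_le_mul_of_nonneg_left (hGL z z') (by norm_num))
      change ‖R z - R z'‖ ≤ D * ‖z - z'‖ at h1
      have h3 : (R z - Complex.log (-g₀) - Complex.log (G z)) -
          (R z' - Complex.log (-g₀) - Complex.log (G z')) =
          (R z - R z') - (Complex.log (G z) - Complex.log (G z')) := by ring
      rw [h3]
      refine (norm_sub_le _ _).trans ?_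
      have h4 : D + 2 * (CT / ‖g₀‖) ≤ C := by
        have := norm_nonneg (Complex.log (-g₀))
        linarith
      have h5 := mul_le_mul_of_nonneg_right h4 (norm_nonneg (z - z'))
      linarith)
  refine ⟨u z, ?_⟩
  rw [← sum_mul_quarterTurn, ← hmain] at hz
  have hlogeq : logSeries b (u z) σ = Complex.log (-g₀) + Complex.log (G z) := by
    simp only [hR] at hz
    linear_combination hz
  have hGne : G z ≠ 0 := by
    intro h
    have := hG1 z
    rw [h] at this
    norm_num at this
  rw [hlogeq, Complex.exp_add, Complex.exp_log (neg_ne_zero.2 ht), Complex.exp_log hGne]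
  simp only [hG]
  field_simp
  ring

/-! ### Transfer of the zero to the untwisted sum. -/

/-- Hurwitz's argument: a zero of one twist yields zeros of the untwisted sum with arbitrarily large
imaginary part. -/
theorem exists_zero_of_twist_eq_zero {b : ℕ → ℂ}
    (hb : ∀ σ : ℝ, 1 < σ → Summable (logMajorant b σ)) (N : ℕ) {σ : ℝ} (hσ : 1 < σ)
    {u : Nat.Primes → Circle} (hu : Complex.exp (logSeries b u σ) + twistedTail b N u σ = 0)
    (T : ℝ) : ∃ s : ℂ, 1 < s.re ∧ T ≤ s.im ∧
      Complex.exp (logSeries b 1 s) + twistedTail b N 1 s = 0 := by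
  set F : (Nat.Primes → Circle) → ℂ → ℂ := fun v s =>
    Complex.exp (logSeries b v s) + twistedTail b N v s with hF
  set U : Set ℂ := {s | 1 < s.re} with hU
  have hUo : IsOpen U := isOpen_lt continuous_const Complex.continuous_re
  have hUc : IsPreconnected U := (convex_halfSpace_re_gt _).isPreconnected
  have hU2 : ∀ s ∈ U, 1 / 2 < s.re := fun s hs => by
    have h : 1 < s.re := hs
    linarith
  have hcont : ∀ v, ∀ s ∈ U, ContinuousAt (fun x : (Nat.Primes → Circle) × ℂ => F x.1 x.2) (v, s) :=
    fun v s hs => (continuousAt_logSeries hb (x := (v, s)) hs).cexp.add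
      (continuousAt_twistedTail hb N (x := (v, s)) (hU2 s hs))
  have hdiff : ∀ v, DifferentiableOn ℂ (F v) U := fun v s hs =>
    ((differentiableAt_logSeries hb v hs).cexp.add
      (differentiableAt_twistedTail hb N v (hU2 s hs))).differentiableWithinAt
  have han : ∀ v, AnalyticOnNhd ℂ (F v) U := fun v => (hdiff v).analyticOnNhd hUo
  have hσU : (σ : ℂ) ∈ U := by simpa [hU] using hσ
  have hne : ∀ᶠ z in 𝓝[≠] (σ : ℂ), F u z ≠ 0 := by
    refine (han u σ hσU).eventually_eq_zero_or_eventually_ne_zero.resolve_left fun h => ?_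
    have hzero : Set.EqOn (F u) 0 U :=
      (han u).eqOn_zero_of_preconnected_of_eventuallyEq_zero hUc hσU h
    have hlim : Tendsto (fun x : ℝ => F u x) atTop (𝓝 (Complex.exp 0 + ((N - 1 : ℕ) : ℂ))) :=
      ((Complex.continuous_exp.tendsto 0).comp (tendsto_logSeries hb u)).add
        (tendsto_twistedTail hb N u)
    have hlim0 : Tendsto (fun x : ℝ => F u x) atTop (𝓝 0) := by
      refine tendsto_const_nhds.congr' ?_
      filter_upwards [eventually_gt_atTop 1] with x hx
      exact (hzero (show (x : ℂ) ∈ U by simpa [hU] using hx)).symm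
    have h2 := tendsto_nhds_unique hlim hlim0
    rw [Complex.exp_zero] at h2
    have h3 : 1 + (N - 1) = 0 := by exact_mod_cast h2
    omega
  obtain ⟨ε, hε, hεne⟩ := Metric.eventually_nhds_iff.1 (eventually_nhdsWithin_iff.1 hne)
  set r := min (ε / 2) ((σ - 1) / 2) with hr
  have hr0 : 0 < r := lt_min (by linarith) (by linarith)
  have hrε : r < ε := (min_le_left _ _).trans_lt (by linarith)
  have hrσ : r < σ - 1 := (min_le_right _ _).trans_lt (by linarith)
  have hball : Metric.closedBall (σ : ℂ) r ⊆ U := by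
    intro z hz
    rw [Metric.mem_closedBall, dist_eq_norm] at hz
    have h1 := (abs_le.1 ((Complex.abs_re_le_norm _).trans hz)).1
    simp only [Complex.sub_re, Complex.ofReal_re] at h1
    change 1 < z.re
    linarith
  have hsne : ∀ z ∈ Metric.sphere (σ : ℂ) r, F u z ≠ 0 := by
    intro z hz
    have hz' : dist z σ = r := hz
    refine hεne (by rw [hz']; exact hrε) ?_
    rintro rfl
    rw [dist_self] at hz'
    exact hr0.ne hz'
  have hsub : Metric.sphere (σ : ℂ) r ⊆ U := Metric.sphere_subset_closedBall.trans hball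
  obtain ⟨z₁, hz₁, hmin⟩ := (isCompact_sphere (σ : ℂ) r).exists_isMinOn
    (NormedSpace.sphere_nonempty.2 hr0.le) (((hdiff u).continuousOn.mono hsub).norm)
  set m := ‖F u z₁‖ with hm
  have hm0 : 0 < m := norm_pos_iff.2 (hsne z₁ hz₁)
  -- Joint continuity and compactness of the disc give uniform closeness for all twists near `u`,
  -- hence for some point of the flow.
  have hunif : ∀ᶠ v in 𝓝 u, ∀ z ∈ Metric.closedBall (σ : ℂ) r, ‖F v z - F u z‖ < m / 8 := by
    refine (isCompact_closedBall (σ : ℂ) r).eventually_forall_of_forall_eventually fun z hz => ?_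
    have h1 := hcont u z (hball hz)
    have h2 : ContinuousAt (fun x : (Nat.Primes → Circle) × ℂ => F u x.2) (u, z) :=
      ContinuousAt.comp (f := Prod.snd) (g := F u)
        ((hdiff u).differentiableAt (hUo.mem_nhds (hball hz))).continuousAt continuousAt_snd
    have h3 := (h1.sub h2).norm
    have h4 : ‖F u z - F u z‖ < m / 8 := by simpa using hm0
    exact h3.eventually (gt_mem_nhds h4)
  -- The zero z found in the disc has Im z ≥ -r, so t ≥ T + r puts z + it at height at least T.
  obtain ⟨t, ht, hv⟩ := exists_primeFlow_mem hunif (T + r)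
  set v := primeFlow t with hvdef
  have hσb : (σ : ℂ) ∈ Metric.closedBall (σ : ℂ) r := Metric.mem_closedBall_self hr0.le
  have hvσ : ‖F v σ‖ < m / 8 := by
    have := hv σ hσb
    rwa [show F u σ = 0 from hu, sub_zero] at this
  have hsphere : ∀ z ∈ Metric.sphere (σ : ℂ) r, m / 2 ≤ ‖F v z - F v σ‖ := by
    intro z hz
    have h1 := hv z (Metric.sphere_subset_closedBall hz)
    have h2 : m ≤ ‖F u z‖ := hmin hz
    have h3 : ‖F u z‖ ≤ ‖F v z - F v σ‖ + ‖F v z - F u z‖ + ‖F v σ‖ := by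
      have : F u z = (F v z - F v σ) - (F v z - F u z) + F v σ := by ring
      conv_lhs => rw [this]
      exact (norm_add_le _ _).trans (add_le_add_left (norm_sub_le _ _) _)
    linarith
  have hfreq : ∃ᶠ z in 𝓝 (σ : ℂ), F v z ≠ F v σ := by
    intro h
    have h1 : F v =ᶠ[𝓝 (σ : ℂ)] fun _ => F v σ := by
      filter_upwards [h] with z hz using not_not.1 hz
    have h2 := (han v).eqOn_of_preconnected_of_eventuallyEq analyticOnNhd_const hUc hσU h1
    have h3 := hsphere z₁ hz₁
    rw [h2 (hsub hz₁), sub_self, norm_zero] at h3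
    linarith
  have hdc : DiffContOnCl ℂ (F v) (Metric.ball (σ : ℂ) r) := by
    refine DifferentiableOn.diffContOnCl ((hdiff v).mono ?_)
    rw [closure_ball _ hr0.ne']
    exact hball
  -- Quantitative open mapping: F v differs from its central value by at least m/2 on the circle, so
  -- the image of the disc contains the ball of radius m/4 about F v σ. That ball contains 0, as |F
  -- v σ| < m/8.
  obtain ⟨z, hz, hz0⟩ := hdc.ball_subset_image_closedBall hr0 hsphere hfreq
    (show (0 : ℂ) ∈ Metric.ball (F v σ) (m / 2 / 2) by
      rw [mem_ball_iff_norm, zero_sub, norm_neg]; linarith)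
  refine ⟨z + t * Complex.I, ?_, ?_, ?_⟩
  · have h1 : 1 < z.re := hball hz
    simpa using h1
  · rw [Metric.mem_closedBall, dist_eq_norm] at hz
    have h1 := (abs_le.1 ((Complex.abs_im_le_norm _).trans hz)).1
    simp only [Complex.sub_im, Complex.ofReal_im, sub_zero] at h1
    simp only [Complex.add_im, Complex.mul_im, Complex.ofReal_re, Complex.I_im, Complex.ofReal_im,
      Complex.I_re]
    linarith
  · rw [← hz0]
    simp only [hF, twistedTail, hvdef]
    congr 1
    · have := logSeries_primeFlow_pow b t 1 z
      simp only [pow_one, Nat.cast_one, one_mul] at this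
      rw [this]
    · refine Finset.sum_congr rfl fun k _ => ?_
      rw [logSeries_primeFlow_pow, one_pow]

/-- The sum `L(s) + L(2s) + ⋯ + L(Ns)` has infinitely many zeros with `Re s > 1`,
for every `N ≥ 2`. -/
theorem infinite_zeros_sum_LSeries {a b : ℕ → ℂ} {K θ : ℝ}
    (ha : ∀ s : ℂ, 1 < s.re → LSeriesSummable a s)
    (hb : ∀ σ : ℝ, 1 < σ → Summable (logMajorant b σ))
    (hexp : ∀ s : ℂ, 1 < s.re → Complex.exp (logSeries b 1 s) = LSeries a s)
    (hK : 0 < K) (hθ : θ < 1 / 2)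
    (hbound : ∀ p : ℕ, p.Prime → ∀ k : ℕ, 1 ≤ k → ‖b (p ^ k)‖ ≤ K * (p : ℝ) ^ ((k : ℝ) * θ))
    (hdiv : Tendsto (fun σ : ℝ => ∑' p : Nat.Primes, ‖a (p : ℕ)‖ * ((p : ℕ) : ℝ) ^ (-σ))
      (𝓝[>] (1 : ℝ)) atTop) {N : ℕ} (hN : 2 ≤ N) :
    {s : ℂ | 1 < s.re ∧ ∑ k ∈ Finset.Icc 1 N, LSeries a ((k : ℂ) * s) = 0}.Infinite := by
  have hdiv' : Tendsto (fun σ : ℝ => ∑' p : Nat.Primes, logMajorant b σ (p, 0))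
      (𝓝[>] (1 : ℝ)) atTop := by
    refine hdiv.congr fun σ => tsum_congr fun p => ?_
    rw [coeff_prime_eq ha hb hexp p.2]
    simp [logMajorant]
  obtain ⟨σ, hσ, u, hu⟩ := exists_twist_eq_zero hb hK hθ hbound hdiv' hN
  intro hfin
  obtain ⟨B, hB⟩ := (hfin.image Complex.im).bddAbove
  obtain ⟨s, hs1, hs2, hs3⟩ := exists_zero_of_twist_eq_zero hb N hσ hu (B + 1)
  have hmem : s ∈ {s : ℂ | 1 < s.re ∧ ∑ k ∈ Finset.Icc 1 N, LSeries a ((k : ℂ) * s) = 0} := by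
    refine ⟨hs1, ?_⟩
    have hI : Finset.Icc 1 N = insert 1 (Finset.Icc 2 N) := by
      ext k; simp only [Finset.mem_Icc, Finset.mem_insert]; omega
    rw [hI, Finset.sum_insert (by simp), Nat.cast_one, one_mul, ← hexp s hs1, ← hs3]
    congr 1
    refine Finset.sum_congr rfl fun k hk => ?_
    rw [one_pow, hexp _ (one_lt_re_natCast_mul (Finset.mem_Icc.1 hk).1 (by linarith))]
  have := hB (Set.mem_image_of_mem _ hmem)
  linarith

/-- `a` gives the coefficients of `L(s) = ∑ a(n) n^{-s}`; `b` gives the coefficients at prime powers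
of `log L`. The identity `log L(s) = ∑_p ∑_{k ≥ 1} b(p^k) p^{-ks}` is expressed as: the absolutely
convergent double series is a logarithm of `L(s)`. The value of `a` at `0` plays no role, nor do the
values of `b` away from prime powers. -/
theorem theorem1 (a b : ℕ → ℂ) (K θ : ℝ)
    (h_abs : ∀ s : ℂ, 1 < s.re → LSeriesSummable a s)
    (h_log_summable : ∀ s : ℂ, 1 < s.re →
      Summable fun q : Nat.Primes × ℕ =>
        ‖b ((q.1 : ℕ) ^ (q.2 + 1)) / ((q.1 : ℕ) : ℂ) ^ (((q.2 + 1 : ℕ) : ℂ) * s)‖)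
    (h_log : ∀ s : ℂ, 1 < s.re →
      Complex.exp (∑' p : Nat.Primes, ∑' k : ℕ,
        b ((p : ℕ) ^ (k + 1)) / ((p : ℕ) : ℂ) ^ (((k + 1 : ℕ) : ℂ) * s)) = LSeries a s)
    (hK : 0 < K) (hθ : θ < 1 / 2)
    (h_bound : ∀ p : ℕ, p.Prime → ∀ k : ℕ, 1 ≤ k → ‖b (p ^ k)‖ ≤ K * (p : ℝ) ^ ((k : ℝ) * θ))
    (h_div : Tendsto (fun σ : ℝ => ∑' p : Nat.Primes, ‖a (p : ℕ)‖ * ((p : ℕ) : ℝ) ^ (-σ))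
      (𝓝[>] (1 : ℝ)) atTop) :
    (∃ N₀ : ℕ, ∀ N : ℕ, N₀ ≤ N →
      {s : ℂ | 1 < s.re ∧ ∑ k ∈ Finset.Icc 1 N, LSeries a ((k : ℂ) * s) = 0}.Infinite) ∧
    {s : ℂ | 1 < s.re ∧ LSeries a s + LSeries a (2 * s) = 0}.Infinite ∧
    ((∀ n : ℕ, 2 ≤ n → ‖a n‖ ≤ (n : ℝ) ^ ((1 : ℝ) / 4)) →
      ∀ N : ℕ, 2 ≤ N →
        {s : ℂ | 1 < s.re ∧ ∑ k ∈ Finset.Icc 1 N, LSeries a ((k : ℂ) * s) = 0}.Infinite) := by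
  have hterm : ∀ (s : ℂ) (q : Nat.Primes × ℕ),
      b ((q.1 : ℕ) ^ (q.2 + 1)) / ((q.1 : ℕ) : ℂ) ^ (((q.2 + 1 : ℕ) : ℂ) * s) =
        logTerm b 1 s q := by
    intro s q
    simp only [logTerm, Pi.one_apply, Circle.coe_one, one_mul]
    rw [Complex.cpow_nat_mul, Complex.cpow_neg, inv_pow, div_eq_mul_inv]
  have hb : ∀ σ : ℝ, 1 < σ → Summable (logMajorant b σ) := by
    intro σ hσ
    refine (h_log_summable σ (by simpa using hσ)).congr fun q => ?_
    rw [hterm, norm_logTerm, Complex.ofReal_re]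
  have hexp : ∀ s : ℂ, 1 < s.re → Complex.exp (logSeries b 1 s) = LSeries a s := by
    intro s hs
    rw [← h_log s hs, logSeries, (summable_logTerm hb 1 hs).tsum_prod]
    congr 1
    exact tsum_congr fun p => tsum_congr fun k => (hterm s (p, k)).symm
  have hmain : ∀ N : ℕ, 2 ≤ N →
      {s : ℂ | 1 < s.re ∧ ∑ k ∈ Finset.Icc 1 N, LSeries a ((k : ℂ) * s) = 0}.Infinite :=
    fun N hN => infinite_zeros_sum_LSeries h_abs hb hexp hK hθ h_bound h_div hN
  refine ⟨⟨2, hmain⟩, ?_, fun _ => hmain⟩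
  simpa [Finset.sum_Icc_succ_top] using hmain 2 le_rfl
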